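/- **Setting.** A program consists of finitely many functions. Each has a list of parameters and a control flow graph of basic blocks; a block is a list of instructions followed by a branch to a set of blocks or by a return, possibly of a reference. A persistent-memory (PM) location is $\langle x,f\rangle$ (the field at offset $f$ from the reference variable $x$), $\langle a,i\rangle$ (the element of the array $a$ at the index variable $i$), or $\mathrm{ptr}(x)$ (an address computed from $x$ by pointer arithmetic). Instructions are: $x=\mathrm{new}$; $y=x$; assignment to an index variable; (atomic or non-atomic) store of a value to a PM location; atomic or non-atomic load from a PM location; atomic RMW/CAS; $\mathrm{flush}$ (clflush), $\mathrm{clwb}$, $\mathrm{fence}$ (sfence); load from volatile memory; store to volatile memory, possibly an atomic release; unlock; function call; and others without effect on the analysis. **Abstract states.** A state maps each reference to an escape state (escaped $<$ captured) and a set of aliases, and each location to a persistency state (dirty $<$ clwb $<$ clean). Array elements and $\mathrm{ptr}(x)$ count as escaped. States are merged pointwise (meet; union of alias sets). Call a location *bad* if it is escaped and non-clean. Transfer functions: * $x=\mathrm{new}$: $x$ becomes captured, its fields clean, $x$ its own only alias (and it leaves all other alias sets). * $y=x$: $y$ gets the escape state of $x$; the aliases of $x$ are joined with $y$ and with each other.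 * A store dirties its target location. Storing a reference, or the address of a field of it, anywhere in memory makes the reference and its aliases escaped. * A load into $y$ makes $y$ escaped and its own only alias. An atomic load, and any load from some $\mathrm{ptr}(x)$, also dirties the location read. * An RMW is a fence, an atomic load and a store in sequence. * flush makes its location clean; clwb turns its location from dirty to clwb; a fence turns every clwb location clean. * Giving an index variable $i$ a new value makes all $\langle a,i\rangle$ clean. A call uses a summary of the callee for the calling context, which consists of the escape state and the lowest field state of each argument. The summary holds such a pair for each parameter and for the return value, merged over all function exits, their may-alias relation, a bit telling that a location which some reached instruction dirties or makes escape is bad after it, and a bit telling that a release operation on volatile memory may be done (both bits include nested calls). At a call the states of the arguments and of the result variable are replaced by those of the summary (all fields of an object get the same state), the alias sets are updated, and the aliases of an escaped argument become escaped. **Analysis.** A function is analysed under a context by forward dataflow iteration to a fixed point. A worklist of pairs (function, context) initially holds every function with all parameters captured and clean. While it is non-empty, an arbitrary pair is removed and analysed and its summary is updated (meet with the old one). Contexts demanded at its calls that have no summary are pushed and, if the summary changed, so are all already analysed pairs of functions that call the function. A call whose context has no summary yet uses the meet of the summaries of all higher contexts (captured, clean, no aliases and no bits if there are none). **Reported violations**,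 for a pair, are: 1. At the function exit (states of all exits merged): a bad location that is not a field of a parameter or of a returned reference. In particular, every non-clean array element. 2. At a store (to PM or volatile memory, or an RMW): afterwards a location that it dirties or whose object it makes escape is bad, and so is a different location. 3. At a release operation on volatile memory (unlock, atomic release store): some location is bad. 4. At a call whose summary has one of the two bits set: some location that is not a field of an argument is bad. 5. At an assignment to an index variable $i$: some $\langle a,i\rangle$ is non-clean. 6. At an instruction other than flush, clwb, fence, or at the end of a block: some $\mathrm{ptr}(x)$ is non-clean (a pointer-arithmetic access that was not flushed and fenced right away). **Transformation.** If a completed analysis of the program reports no violation, the program may be left unchanged. In any case PMRobust may do the following (and does so otherwise): insert after every instruction that dirties a location a clwb of that location; run the analysis of the resulting program to completion; and then simultaneously insert a fence before each instruction or block end at which a violation of kinds 2–6 is reported under some analysed context, and a fence at each function exit where, under some analysed context, some location is in state clwb. **Theorem.** For every program $P$, the transformation has at least one output (the analyses it runs can be completed). For every output $P'$, whatever the processing orders of the worklists, PMRobust reports no robustness violation in $P'$: at no stage of any run of the analysis on $P'$, completed or not, is there a violation for a pair that has been analysed or is on the worklist. -/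

import Mathlib

namespace PMRobust

/-! ## Abstract states -/

/-- Escape states; `escaped` is the lower of the two lattice values. -/
inductive EState
  | escaped
  | captured
  deriving DecidableEq

/-- Persistency states, from the lowest to the highest lattice value. -/
inductive PState
  | dirty
  | clwb
  | clean
  deriving DecidableEq

def EState.rank : EState → ℕ
  | .escaped => 0
  | .captured => 1

def PState.rank : PState → ℕ
  | .dirty => 0
  | .clwb => 1
  | .clean => 2

instance : LinearOrder EState :=
  LinearOrder.lift' EState.rank (by intro a b h; cases a <;> cases b <;> simp_all [EState.rank])

instance : LinearOrder PState :=
  LinearOrder.lift' PState.rank (by intro a b h; cases a <;> cases b <;> simp_all [PState.rank])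

open Classical in
/-- The meet of a set of escape states (the empty meet is the top element). -/
noncomputable def lowestE (X : Set EState) : EState :=
  if .escaped ∈ X then .escaped else .captured

open Classical in
/-- The meet of a set of persistency states (the empty meet is the top element). -/
noncomputable def lowestP (X : Set PState) : PState :=
  if .dirty ∈ X then .dirty else if .clwb ∈ X then .clwb else .clean

/-! ## Programs -/

/-- The finite vocabulary of a program: how many functions, reference variables, array index
variables, field offsets and basic blocks it uses, and the number of parameters of each function.
Reference variables, index variables and basic blocks are local to a function. -/
structure Sig where
  fns : ℕ
  vars : ℕ
  idxs : ℕ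
  flds : ℕ
  blks : ℕ
  arity : Fin fns → ℕ

abbrev Sig.Fn (S : Sig) := Fin S.fns
abbrev Sig.Var (S : Sig) := Fin S.vars
abbrev Sig.Idx (S : Sig) := Fin S.idxs
abbrev Sig.Fld (S : Sig) := Fin S.flds
abbrev Sig.Blk (S : Sig) := Fin S.blks

/-- Abstract persistent memory (PM) locations: the field of an object at an offset from a
reference, an array element (an array reference with an index variable), and an address that is
computed from a reference by pointer arithmetic. -/
inductive Loc (S : Sig)
  | field (x : S.Var) (f : S.Fld)
  | elem (a : S.Var) (i : S.Idx)
  | ptr (x : S.Var)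
  deriving DecidableEq

/-- Values that can be stored: data that is not a PM address, a reference `x`, an address `&x->f`. -/
inductive Val (S : Sig)
  | data
  | ref (x : S.Var)
  | addr (x : S.Var) (f : S.Fld)

/-- The reference to whose object a stored value points. -/
def Val.base {S : Sig} : Val S → Option S.Var
  | .data => none
  | .ref x => some x
  | .addr x _ => some x

/-- Instructions.  The destination of a load, an atomic read-modify-write or a call is `some y` if
the value is a PM reference that is kept in the variable `y`.
* `alloc x` is `x = new`; `copy y x` is `y = x`; `setIdx i` gives the index variable `i` a new value;
* `store ℓ v` is an atomic or non-atomic store of `v` to the PM location `ℓ`;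
* `load at y ℓ` is a load from the PM location `ℓ`, atomic if `at` is true;
* `rmw y ℓ v` is an atomic read-modify-write or compare-and-swap on the PM location `ℓ`;
* `flush` is `clflush`; `clwb` is `clwb` or `clflushopt`; `fence` is `sfence`;
* `volLoad y` and `volStore rel v` access non-PM memory, the latter as an atomic release store if
  `rel` is true; `unlock` is any other release operation on non-PM memory;
* `other` is any instruction that the analysis does not look at. -/
inductive Instr (S : Sig)
  | alloc (x : S.Var)
  | copy (y x : S.Var)
  | setIdx (i : S.Idx)
  | store (l : Loc S) (v : Val S)
  | load (atomic : Bool) (y : Option S.Var) (l : Loc S)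
  | rmw (y : Option S.Var) (l : Loc S) (v : Val S)
  | flush (l : Loc S)
  | clwb (l : Loc S)
  | fence
  | volLoad (y : S.Var)
  | volStore (rel : Bool) (v : Val S)
  | unlock
  | call (y : Option S.Var) (g : S.Fn) (args : Fin (S.arity g) → S.Var)
  | other

/-- How a basic block ends: by a branch to one of a set of blocks, or by leaving the function,
possibly with a reference as return value. -/
inductive Term (S : Sig)
  | jump (succs : Set S.Blk)
  | ret (v : Option S.Var)

/-- A program: the parameters and the control flow graph of each function. -/
structure Program (S : Sig) where
  params : (F : S.Fn) → Fin (S.arity F) → S.Var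
  entry : S.Fn → S.Blk
  body : S.Fn → S.Blk → List (Instr S)
  term : S.Fn → S.Blk → Term S

variable {S : Sig}

/-! ## Transfer functions -/

/-- The abstract state at a program point: the escape map, the persistency map (of fields, array
elements and pointer arithmetic), and the alias map. -/
structure State (S : Sig) where
  esc : S.Var → EState
  pers : Loc S → PState
  als : S.Var → Set S.Var

/-- The escape state of the object of a location.  Array elements and addresses computed by pointer
arithmetic count as escaped. -/
def State.locEsc (s : State S) : Loc S → EState
  | .field x _ => s.esc x
  | .elem _ _ => .escaped
  | .ptr _ => .escaped

/-- A location that is escaped and non-clean. -/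
def State.Bad (s : State S) (l : Loc S) : Prop :=
  s.locEsc l = .escaped ∧ s.pers l ≠ .clean

/-- The merge of the states in a set. -/
noncomputable def State.merge (X : Set (State S)) : State S where
  esc x := lowestE {e | ∃ s ∈ X, e = s.esc x}
  pers l := lowestP {p | ∃ s ∈ X, p = s.pers l}
  als x := {z | ∃ s ∈ X, z ∈ s.als x}

def State.setPers (s : State S) (l : Loc S) (p : PState) : State S :=
  { s with pers := fun l' => if l' = l then p else s.pers l' }

/-- The references that may point to the object of a stored value. -/
def State.published (s : State S) (v : Val S) : Set S.Var :=
  {z | ∃ x, v.base = some x ∧ z ∈ s.als x}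

open Classical in
/-- Storing `v` anywhere but in a variable makes its object escape, under all its names. -/
noncomputable def State.escapeVal (s : State S) (v : Val S) : State S :=
  { s with esc := fun z => if z ∈ s.published v then .escaped else s.esc z }

/-- `y` is overwritten by a reference of escape state `e` that has no known other name. -/
def State.overwrite (s : State S) (y : S.Var) (e : EState) : State S :=
  { s with
    esc := fun z => if z = y then e else s.esc z
    als := fun z => if z = y then {y} else s.als z \ {y} }

/-- A loaded reference is escaped. -/
def State.loadInto (s : State S) : Option S.Var → State S
  | none => s
  | some y => s.overwrite y .escaped

/-- `x = new`: the new object is captured and clean. -/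
def State.allocVar (s : State S) (x : S.Var) : State S :=
  { s.overwrite x .captured with
    pers := fun l => match l with
      | .field z f => if z = x then .clean else s.pers (.field z f)
      | l => s.pers l }

open Classical in
/-- `y = x`: all aliases of `x` become aliases of `y` and of each other. -/
noncomputable def State.copyVar (s : State S) (y x : S.Var) : State S :=
  { s with
    esc := fun z => if z = y then s.esc x else s.esc z
    als := fun z =>
      if z = y then s.als x ∪ {y}
      else if z ∈ s.als x then s.als z ∪ s.als x ∪ {y}
      else s.als z }

/-- `i` gets a new value: the elements that were named by the old value are no longer tracked. -/
def State.resetIdx (s : State S) (i : S.Idx) : State S :=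
  { s with pers := fun l => match l with
      | .elem a j => if j = i then .clean else s.pers (.elem a j)
      | l => s.pers l }

noncomputable def State.doStore (s : State S) (l : Loc S) (v : Val S) : State S :=
  (s.escapeVal v).setPers l .dirty

def Loc.IsPtr : Loc S → Bool
  | .ptr _ => true
  | _ => false

/-- An atomic load dirties the location it reads; so does, conservatively, any load from an address
computed by pointer arithmetic. -/
def State.doLoad (s : State S) (atomic : Bool) (y : Option S.Var) (l : Loc S) : State S :=
  (if atomic || l.IsPtr then s.setPers l .dirty else s).loadInto y

def State.doClwb (s : State S) (l : Loc S) : State S :=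
  if s.pers l = .dirty then s.setPers l .clwb else s

def State.doFence (s : State S) : State S :=
  { s with pers := fun l => if s.pers l = .clwb then .clean else s.pers l }

/-! ## Calling contexts and function summaries -/

/-- Calling contexts for `n` parameters, ordered pointwise: a higher context is more precise. -/
abbrev Ctx (n : ℕ) := Fin n → EState × PState

/-- Summarized results.  The index `none` stands for the return value: `st` has the abstract states
of the parameters and the return value, `al` their may-alias relation, `marksDirEsc` tells that some
escaped location may become non-clean, and `marksRel` that a release operation may be done. -/
structure Result (n : ℕ) where
  st : Option (Fin n) → EState × PState
  al : Option (Fin n) → Option (Fin n) → Prop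
  marksDirEsc : Prop
  marksRel : Prop

/-- The meet of a set of summarized results.  The empty meet says captured and clean. -/
noncomputable def Result.meet {n : ℕ} (X : Set (Result n)) : Result n where
  st a := (lowestE {e | ∃ r ∈ X, e = (r.st a).1}, lowestP {p | ∃ r ∈ X, p = (r.st a).2})
  al a c := ∃ r ∈ X, r.al a c
  marksDirEsc := ∃ r ∈ X, r.marksDirEsc
  marksRel := ∃ r ∈ X, r.marksRel

/-- The function summary table. -/
abbrev Table (S : Sig) := (F : S.Fn) → Ctx (S.arity F) → Option (Result (S.arity F))

/-- The summary used at a call: the entry of the calling context if there is one, else the meet of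
the entries of all higher contexts, and captured and clean if there is none of these either. -/
noncomputable def lookup (T : Table S) (g : S.Fn) (c : Ctx (S.arity g)) : Result (S.arity g) :=
  match T g c with
  | some r => r
  | none => Result.meet {r | ∃ c', c ≤ c' ∧ T g c' = some r}

/-- The calling context of a call; the fields of an argument are collapsed to the lowest state. -/
noncomputable def State.callCtx (s : State S) {n : ℕ} (args : Fin n → S.Var) : Ctx n :=
  fun i => (s.esc (args i), lowestP {p | ∃ f, p = s.pers (.field (args i) f)})

open Classical in
/-- The effect of a summary on the arguments: their states are replaced, their alias sets are joined
as the summary says, and all aliases of an argument that has escaped are escaped. -/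
noncomputable def State.afterArgs (s : State S) {n : ℕ} (r : Result n) (args : Fin n → S.Var) :
    State S :=
  let als' : S.Var → Set S.Var := fun z =>
    s.als z ∪ {w | ∃ i j, r.al (some i) (some j) ∧ z ∈ s.als (args i) ∧ w ∈ s.als (args j)}
  { esc := fun z =>
      if ∃ i, (r.st (some i)).1 = .escaped ∧ (z = args i ∨ z ∈ als' (args i)) then .escaped
      else if ∃ i, z = args i then .captured
      else s.esc z
    pers := fun l => match l with
      | .field z f =>
          if ∃ i, z = args i then lowestP {p | ∃ i, z = args i ∧ p = (r.st (some i)).2}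
          else s.pers (.field z f)
      | l => s.pers l
    als := als' }

open Classical in
/-- The effect of a summary on the variable that receives the return value. -/
noncomputable def State.afterRet (s : State S) {n : ℕ} (r : Result n) (args : Fin n → S.Var) :
    Option S.Var → State S
  | none => s
  | some y =>
    { esc := fun z => if z = y then (r.st none).1 else s.esc z
      pers := fun l => match l with
        | .field z f => if z = y then (r.st none).2 else s.pers (.field z f)
        | l => s.pers l
      als := fun z =>
        if z = y then {w | w = y ∨ ∃ i, r.al none (some i) ∧ w ∈ s.als (args i)}
        else {w | (w ≠ y ∧ w ∈ s.als z) ∨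
          (w = y ∧ ∃ i, r.al (some i) none ∧ z ∈ s.als (args i))} }

/-- The transfer function of an instruction.  An atomic read-modify-write is a fence, an atomic load
and an atomic store in sequence. -/
noncomputable def transfer (T : Table S) (i : Instr S) (s : State S) : State S :=
  match i with
  | .alloc x => s.allocVar x
  | .copy y x => s.copyVar y x
  | .setIdx j => s.resetIdx j
  | .store l v => s.doStore l v
  | .load a y l => s.doLoad a y l
  | .rmw y l v => (s.doFence.doLoad true y l).doStore l v
  | .flush l => s.setPers l .clean
  | .clwb l => s.doClwb l
  | .fence => s.doFence
  | .volLoad y => s.loadInto (some y)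
  | .volStore _ v => s.escapeVal v
  | .unlock => s
  | .call y g args =>
      let r := lookup T g (s.callCtx args)
      (s.afterArgs r args).afterRet r args y
  | .other => s

noncomputable def transferList (T : Table S) (is : List (Instr S)) (s : State S) : State S :=
  is.foldl (fun s i => transfer T i s) s

/-! ## Analysis of a function under a calling context -/

/-- The state at the entry of `F`: every field of a parameter has the state that the context gives
to the parameter; everything else is captured and clean, and nothing is aliased. -/
noncomputable def entryState (P : Program S) (F : S.Fn) (C : Ctx (S.arity F)) : State S where
  esc x := lowestE {e | ∃ i, P.params F i = x ∧ e = (C i).1}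
  pers l := match l with
    | .field x _ => lowestP {p | ∃ i, P.params F i = x ∧ p = (C i).2}
    | _ => .clean
  als x := {x}

open Classical in
/-- The merge of the states that reach a point; `none` if no state reaches it. -/
noncomputable def mergeOpt (X : Set (State S)) : Option (State S) :=
  if X.Nonempty then some (State.merge X) else none

/-- The states at the beginning of the basic blocks after `k` rounds of the dataflow iteration. -/
noncomputable def iter (P : Program S) (T : Table S) (F : S.Fn) (C : Ctx (S.arity F)) :
    ℕ → S.Blk → Option (State S)
  | 0, b => mergeOpt {s | b = P.entry F ∧ s = entryState P F C}
  | k + 1, b => mergeOpt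
      ({s | iter P T F C k b = some s} ∪
       {s | ∃ b' succs s', P.term F b' = .jump succs ∧ b ∈ succs ∧ iter P T F C k b' = some s' ∧
          s = transferList T (P.body F b') s'})

/-- The states at the beginning of the basic blocks at the fixed point of the dataflow iteration. -/
noncomputable def solve (P : Program S) (T : Table S) (F : S.Fn) (C : Ctx (S.arity F)) (b : S.Blk) :
    Option (State S) :=
  mergeOpt {s | ∃ k, iter P T F C k b = some s}

/-- The state right before position `k` of block `b`; the position after the last instruction is
that of the terminator.  It is `none` if the block is not reached. -/
noncomputable def stateAt (P : Program S) (T : Table S) (F : S.Fn) (C : Ctx (S.arity F))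
    (b : S.Blk) (k : ℕ) : Option (State S) :=
  (solve P T F C b).map (transferList T ((P.body F b).take k))

/-- Block `b` is a reached function exit with state `s` and return value `v`. -/
def ExitAt (P : Program S) (T : Table S) (F : S.Fn) (C : Ctx (S.arity F))
    (b : S.Blk) (v : Option S.Var) (s : State S) : Prop :=
  P.term F b = .ret v ∧ stateAt P T F C b (P.body F b).length = some s

/-- The instruction `i` is reached in the state `s` at position `k` of block `b`. -/
def InstrAt (P : Program S) (T : Table S) (F : S.Fn) (C : Ctx (S.arity F))
    (b : S.Blk) (k : ℕ) (i : Instr S) (s : State S) : Prop :=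
  (P.body F b)[k]? = some i ∧ stateAt P T F C b k = some s

/-- The location that an instruction dirties. -/
def Instr.dirties : Instr S → Option (Loc S)
  | .store l _ => some l
  | .load a _ l => if a || l.IsPtr then some l else none
  | .rmw _ l _ => some l
  | _ => none

/-- The value that an instruction stores to memory. -/
def Instr.stored : Instr S → Option (Val S)
  | .store _ v => some v
  | .rmw _ _ v => some v
  | .volStore _ v => some v
  | _ => none

/-- The locations that an instruction dirties or whose object it makes escape. -/
def touched (i : Instr S) (s : State S) : Set (Loc S) :=
  {l | i.dirties = some l ∨ ∃ v z f, i.stored = some v ∧ z ∈ s.published v ∧ l = .field z f}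

/-- After the instruction, a location it acts on is escaped and non-clean, or this holds inside a
called function. -/
def marksDirEscAt (T : Table S) (i : Instr S) (s : State S) : Prop :=
  match i with
  | .call _ g args => (lookup T g (s.callCtx args)).marksDirEsc
  | i => ∃ l ∈ touched i s, (transfer T i s).Bad l

/-- The instruction is a release operation on non-PM memory, or the call of a function that may do
one. -/
def marksRelAt (T : Table S) (i : Instr S) (s : State S) : Prop :=
  match i with
  | .unlock => True
  | .volStore rel _ => rel = true
  | .call _ g args => (lookup T g (s.callCtx args)).marksRel
  | _ => False

/-- The variable that belongs to an index of a summarized result, given the return value. -/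
def slot (P : Program S) (F : S.Fn) (v : Option S.Var) : Option (Fin (S.arity F)) → Option S.Var
  | some i => some (P.params F i)
  | none => v

/-- The summarized result of analysing `F` under the context `C` with the summary table `T`. -/
noncomputable def result (P : Program S) (T : Table S) (F : S.Fn) (C : Ctx (S.arity F)) :
    Result (S.arity F) where
  st a :=
    (lowestE {e | ∃ b v s x, ExitAt P T F C b v s ∧ slot P F v a = some x ∧ e = s.esc x},
     lowestP {p | ∃ b v s x f, ExitAt P T F C b v s ∧ slot P F v a = some x ∧
        p = s.pers (.field x f)})
  al a c := ∃ b v s x y, ExitAt P T F C b v s ∧ slot P F v a = some x ∧ slot P F v c = some y ∧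
    y ∈ s.als x
  marksDirEsc := ∃ b k i s, InstrAt P T F C b k i s ∧ marksDirEscAt T i s
  marksRel := ∃ b k i s, InstrAt P T F C b k i s ∧ marksRelAt T i s

/-! ## Reported violations -/

def Instr.IsPersist : Instr S → Prop
  | .flush _ => True
  | .clwb _ => True
  | .fence => True
  | _ => False

/-- An address computed by pointer arithmetic has been accessed and is not clean. -/
def ptrPending (s : State S) : Prop := ∃ x, s.pers (.ptr x) ≠ .clean

/-- A location on which the instruction acts is escaped and non-clean after it, and so is a
different location. -/
def secondBad (T : Table S) (i : Instr S) (s : State S) : Prop :=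
  ∃ l₁ l₂, l₁ ≠ l₂ ∧ l₂ ∈ touched i s ∧ (transfer T i s).Bad l₁ ∧ (transfer T i s).Bad l₂

/-- A violation is reported at the instruction `i` in the state `s` if
* an access through pointer arithmetic came right before, and its address was not made clean by
  the flushes and fences between them; or
* `i` is a store with which a second location becomes escaped and non-clean; or
* `i` is a release operation on non-PM memory while some location is escaped and non-clean; or
* `i` is a call of a function that may make an escaped location non-clean or do a release operation,
  while some location that is not passed to it is escaped and non-clean; or
* `i` changes the index variable of an array element that is not clean. -/
def reportedAt (T : Table S) (i : Instr S) (s : State S) : Prop :=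
  (¬ i.IsPersist ∧ ptrPending s) ∨
  match i with
  | .store l v => secondBad T (.store l v) s
  | .rmw y l v => secondBad T (.rmw y l v) s
  | .volStore rel v => secondBad T (.volStore rel v) s ∨ (rel = true ∧ ∃ l, (s.escapeVal v).Bad l)
  | .unlock => ∃ l, s.Bad l
  | .call _ g args =>
      ((lookup T g (s.callCtx args)).marksDirEsc ∨ (lookup T g (s.callCtx args)).marksRel) ∧
        ∃ l, s.Bad l ∧ ¬ ∃ j f, l = .field (args j) f
  | .setIdx j => ∃ a, s.pers (.elem a j) ≠ .clean
  | _ => False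

/-- A violation is reported at position `k` of block `b`, where position `length` is the
terminator. -/
def ReportedPos (P : Program S) (T : Table S) (F : S.Fn) (C : Ctx (S.arity F))
    (b : S.Blk) (k : ℕ) : Prop :=
  (∃ i s, InstrAt P T F C b k i s ∧ reportedAt T i s) ∨
  (k = (P.body F b).length ∧ ∃ s, stateAt P T F C b k = some s ∧ ptrPending s)

/-- In the merge of the states at the function exits, some location is escaped and non-clean that is
not in an object referenced by a parameter or a return value.  Array elements and addresses
computed by pointer arithmetic have to be clean in any case. -/
def ReportedExit (P : Program S) (T : Table S) (F : S.Fn) (C : Ctx (S.arity F)) : Prop :=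
  ∃ l, (State.merge {s | ∃ b v, ExitAt P T F C b v s}).Bad l ∧
    ∀ x f, l = .field x f → (∀ j, x ≠ P.params F j) ∧ ∀ b, P.term F b ≠ .ret (some x)

/-- A violation is reported for `F` under the context `C`. -/
def Reported (P : Program S) (T : Table S) (F : S.Fn) (C : Ctx (S.arity F)) : Prop :=
  (∃ b k, ReportedPos P T F C b k) ∨ ReportedExit P T F C

/-! ## The interprocedural worklist algorithm -/

/-- The pair of a function and a calling context. -/
abbrev Pair (S : Sig) := (F : S.Fn) × Ctx (S.arity F)

structure WState (S : Sig) where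
  table : Table S
  work : Set (Pair S)

def initW (S : Sig) : WState S where
  table _ _ := none
  work := {q | q.2 = fun _ => (.captured, .clean)}

/-- `F'` has a call of `F`. -/
def Calls (P : Program S) (F' F : S.Fn) : Prop :=
  ∃ b y args, Instr.call y F args ∈ P.body F' b

/-- The analysis of `F` under `C` reaches a call with the function and the calling context `q`. -/
def Demands (P : Program S) (T : Table S) (F : S.Fn) (C : Ctx (S.arity F)) (q : Pair S) : Prop :=
  ∃ b k y g args s, InstrAt P T F C b k (.call y g args) s ∧ q = ⟨g, s.callCtx args⟩

/-- The table with the summarized result of `F` under `C` updated. -/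
noncomputable def updateTable (P : Program S) (T : Table S) (F : S.Fn) (C : Ctx (S.arity F)) :
    Table S :=
  Function.update T F (Function.update (T F) C
    (some (Result.meet ({r | T F C = some r} ∪ {result P T F C}))))

/-- One step of the worklist algorithm analyses a pair `(F, C)` from the worklist, updates the
summary table, and pushes the calling contexts that have not been analysed and, if the summary has
changed, the callers of `F` with their contexts. -/
noncomputable def process (P : Program S) (W : WState S) (F : S.Fn) (C : Ctx (S.arity F)) :
    WState S where
  table := updateTable P W.table F C
  work := {q | (q ∈ W.work ∧ q ≠ ⟨F, C⟩) ∨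
    (Demands P W.table F C q ∧ updateTable P W.table F C q.1 q.2 = none) ∨
    (updateTable P W.table F C F C ≠ W.table F C ∧
      updateTable P W.table F C q.1 q.2 ≠ none ∧ Calls P q.1 F)}

def WStep (P : Program S) (W W' : WState S) : Prop :=
  ∃ F C, (⟨F, C⟩ : Pair S) ∈ W.work ∧ W' = process P W F C

/-- `W` can occur in a run of the analysis of `P`, for some order of processing the worklist. -/
def Run (P : Program S) (W : WState S) : Prop :=
  Relation.ReflTransGen (WStep P) (initW S) W

/-- `W` is the outcome of a run of the analysis of `P` that has come to its end. -/
def Outcome (P : Program S) (W : WState S) : Prop :=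
  Run P W ∧ W.work = ∅

/-- Some run of the analysis of `P` reports, at its end or on the way, a violation for a pair that
has been analysed or is on the worklist. -/
def Reports (P : Program S) : Prop :=
  ∃ W, Run P W ∧ ∃ F C, (W.table F C ≠ none ∨ (⟨F, C⟩ : Pair S) ∈ W.work) ∧ Reported P W.table F C

/-! ## The transformation -/

/-- Flush insertion: a `clwb` of the location right after each instruction that dirties one. -/
def insertFlushes (P : Program S) : Program S :=
  { P with body := fun F b => (P.body F b).flatMap fun i => i :: (i.dirties.map Instr.clwb).toList }

open Classical in
/-- Insert a fence before each position in a set of positions of a list of instructions; the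
position after the last instruction is allowed. -/
noncomputable def fenceList : (ℕ → Prop) → List (Instr S) → List (Instr S)
  | p, [] => if p 0 then [.fence] else []
  | p, i :: is => (if p 0 then [.fence, i] else [i]) ++ fenceList (fun k => p (k + 1)) is

/-- A fence goes before each position at which a violation is reported under some calling context,
and to the end of an exit block if some location is in the state `clwb` there. -/
def FencePos (P : Program S) (T : Table S) (F : S.Fn) (b : S.Blk) (k : ℕ) : Prop :=
  ∃ C, T F C ≠ none ∧
    (ReportedPos P T F C b k ∨
      (k = (P.body F b).length ∧ ∃ v s l, ExitAt P T F C b v s ∧ s.pers l = .clwb))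

/-- Fence insertion, from the summary table at the end of the analysis of `P`. -/
noncomputable def insertFences (P : Program S) (T : Table S) : Program S :=
  { P with body := fun F b => fenceList (FencePos P T F b) (P.body F b) }

/-- `P'` is an output of the transformation on `P`: a program for which the completed analysis
reports nothing may be left as it is; otherwise `clwb` instructions are inserted, the resulting
program is analysed to the end, and fences are inserted where that analysis calls for them. -/
inductive Transforms (P : Program S) : Program S → Prop
  | unchanged (W : WState S) (hW : Outcome P W)
      (h : ∀ F C, W.table F C ≠ none → ¬ Reported P W.table F C) : Transforms P P
  | inserted (W : WState S) (hW : Outcome (insertFlushes P) W) :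
      Transforms P (insertFences (insertFlushes P) W.table)

end PMRobust

/-!
The argument is a comparison of analyses. Abstract states, summaries and tables are ordered by
precision: a lower state has lower escape and persistency states and larger alias sets. All
transfer functions are monotone (`transfer_mono`), and a less precise state reports more violations
(`reportedAt.anti`).

*Outputs exist.* A step of the worklist algorithm either lowers the summary table, of which there
are finitely many, or takes an analysed pair off the worklist without adding one
(`exists_work_eq_empty`).

*Comparison.* The table `T` of a completed run on a program `P` is closed (`Outcome.closed`): its
entries lie below the results of the analysis that uses it, and all calling contexts that come up
in this analysis have an entry. Let a program arise from `P` by adding fences anywhere. Fences only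
raise persistency states, so by induction over a run on that program every table that occurs in the
run lies above `T`, every context that comes up lies above one with an entry in `T`, and the state
at each instruction is at least the one in the analysis of `P` (`Run.compare`). The summaries of
higher contexts that stand in for a missing one do no harm, since they lie above the entry of `T`
too. Without new fences, a report in any run on `P` is therefore a report for `T`, which settles
programs that are left unchanged (`not_reports_of_outcome`).

*Inserted flushes and fences.* Once each instruction that dirties a location is followed by a `clwb`
of it, a location can be dirty only right before such a `clwb`, and no dirty state passes through a
call (`Run.noDirty`). By the comparison, a report at an instruction or block end of the fenced
program is also one for `T` at the same position of the flushed program. So there is a fence right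
before it, after which nothing is in state `clwb`, and as nothing is dirty, everything is clean; but
then nothing is reported (`not_reportedAt_of_clean`). In the same way all locations are clean at the
function exits (`not_reports_insertFences`).
-/

namespace PMRobust

variable {S : Sig}

/-! ### Orders on abstract states, summaries and tables -/

theorem EState.escaped_le (e : EState) : .escaped ≤ e := by cases e <;> decide

theorem EState.le_captured (e : EState) : e ≤ .captured := by cases e <;> decide

theorem EState.eq_escaped_of_le {e e' : EState} (h : e ≤ e') (h' : e' = .escaped) :
    e = .escaped := by
  subst h'; exact le_antisymm h (escaped_le e)

theorem PState.dirty_le (p : PState) : .dirty ≤ p := by cases p <;> decide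

theorem PState.le_clean (p : PState) : p ≤ .clean := by cases p <;> decide

theorem PState.ne_clean_of_le {p p' : PState} (h : p ≤ p') (h' : p' ≠ .clean) : p ≠ .clean := by
  rintro rfl; exact h' (le_antisymm (le_clean _) h)

instance : Finite EState :=
  Finite.of_injective (fun e => decide (e = .escaped)) (by intro a b; cases a <;> cases b <;> simp)

instance : Finite PState :=
  Finite.of_injective (fun p => (decide (p = .dirty), decide (p = .clwb)))
    (by intro a b; cases a <;> cases b <;> simp)

theorem lowestE_le {X : Set EState} {e : EState} (h : e ∈ X) : lowestE X ≤ e := by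
  unfold lowestE
  split_ifs with h'
  · exact e.escaped_le
  · cases e
    · exact absurd h h'
    · exact le_rfl

theorem le_lowestE {X : Set EState} {e : EState} (h : ∀ e' ∈ X, e ≤ e') : e ≤ lowestE X := by
  unfold lowestE
  split_ifs with h'
  · exact h _ h'
  · exact e.le_captured

theorem lowestP_mem_or (X : Set PState) : lowestP X ∈ X ∨ lowestP X = .clean := by
  unfold lowestP
  split_ifs with h₁ h₂
  · exact .inl h₁
  · exact .inl h₂
  · exact .inr rfl

theorem lowestP_le {X : Set PState} {p : PState} (h : p ∈ X) : lowestP X ≤ p := by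
  unfold lowestP
  split_ifs with h₁ h₂
  · exact p.dirty_le
  · cases p
    · exact absurd h h₁
    · exact le_rfl
    · decide
  · cases p
    · exact absurd h h₁
    · exact absurd h h₂
    · exact le_rfl

theorem le_lowestP {X : Set PState} {p : PState} (h : ∀ p' ∈ X, p ≤ p') : p ≤ lowestP X := by
  rcases lowestP_mem_or X with h' | h'
  · exact h _ h'
  · rw [h']; exact p.le_clean

theorem lowestP_ne_dirty {X : Set PState} (h : ∀ p ∈ X, p ≠ .dirty) : lowestP X ≠ .dirty := by
  rcases lowestP_mem_or X with h' | h'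
  · exact h _ h'
  · rw [h']; decide

/-- A lower state is less precise: lower escape and persistency states, larger alias sets. -/
instance : PartialOrder (State S) :=
  PartialOrder.lift (fun s => (s.esc, s.pers, OrderDual.toDual s.als)) (by
    rintro ⟨_, _, _⟩ ⟨_, _, _⟩ h
    simpa using h)

theorem State.le_iff {s s' : State S} :
    s ≤ s' ↔ (∀ x, s.esc x ≤ s'.esc x) ∧ (∀ l, s.pers l ≤ s'.pers l) ∧
      ∀ x z, z ∈ s'.als x → z ∈ s.als x := Iff.rfl

/-- A lower result is less precise: lower states, more aliases and more bits set. -/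
instance {n : ℕ} : PartialOrder (Result n) :=
  PartialOrder.lift
    (fun r => (r.st, OrderDual.toDual r.al, OrderDual.toDual r.marksDirEsc,
      OrderDual.toDual r.marksRel)) (by
    rintro ⟨_, _, _, _⟩ ⟨_, _, _, _⟩ h
    simpa using h)

theorem Result.le_iff {n : ℕ} {r r' : Result n} :
    r ≤ r' ↔ (∀ a, (r.st a).1 ≤ (r'.st a).1 ∧ (r.st a).2 ≤ (r'.st a).2) ∧
      (∀ a c, r'.al a c → r.al a c) ∧ (r'.marksDirEsc → r.marksDirEsc) ∧
      (r'.marksRel → r.marksRel) := Iff.rfl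

/-- `T.Refines T'` means that `T` has an entry below each entry of `T'`; a missing entry counts as
higher than all others. -/
def Table.Refines (T T' : Table S) : Prop :=
  ∀ F C r', T' F C = some r' → ∃ r, T F C = some r ∧ r ≤ r'

theorem Table.Refines.trans {T T' T'' : Table S} (h : T.Refines T') (h' : T'.Refines T'') :
    T.Refines T'' := by
  intro F C r hr
  obtain ⟨r', hr', hle'⟩ := h' F C r hr
  obtain ⟨r'', hr'', hle⟩ := h F C r' hr'
  exact ⟨r'', hr'', hle.trans hle'⟩

theorem Table.Refines.antisymm {T T' : Table S} (h : T.Refines T') (h' : T'.Refines T) :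
    T = T' := by
  funext F C
  cases hT : T F C with
  | none =>
    cases hT' : T' F C with
    | none => rfl
    | some r' =>
      obtain ⟨r, hr, -⟩ := h F C r' hT'
      rw [hT] at hr; cases hr
  | some r =>
    obtain ⟨r', hr', hle'⟩ := h' F C r hT
    obtain ⟨r'', hr'', hle⟩ := h F C r' hr'
    rw [hT] at hr''; cases hr''
    rw [hr', le_antisymm hle hle']

instance : Finite (Loc S) :=
  Finite.of_injective
    (fun l : Loc S => (match l with
      | .field x f => .inl (x, f)
      | .elem a i => .inr (.inl (a, i))
      | .ptr x => .inr (.inr x) : S.Var × S.Fld ⊕ S.Var × S.Idx ⊕ S.Var))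
    (by rintro (_ | _ | _) (_ | _ | _) h <;> simp_all)

instance : Finite (State S) :=
  Finite.of_injective (fun s : State S => (s.esc, s.pers, s.als)) (by
    rintro ⟨_, _, _⟩ ⟨_, _, _⟩ h
    simpa using h)

instance {n : ℕ} : Finite (Result n) :=
  Finite.of_injective (fun r : Result n => (r.st, r.al, r.marksDirEsc, r.marksRel)) (by
    rintro ⟨_, _, _, _⟩ ⟨_, _, _, _⟩ h
    simpa using h)

theorem Table.wellFounded_refines :
    WellFounded fun T T' : Table S => T.Refines T' ∧ T ≠ T' := by
  have : IsTrans (Table S) fun T T' => T.Refines T' ∧ T ≠ T' := ⟨by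
    rintro T T' T'' ⟨h₁, h₂⟩ ⟨h₃, -⟩
    refine ⟨h₁.trans h₃, ?_⟩
    rintro rfl
    exact h₂ (h₁.antisymm h₃)⟩
  have : Std.Irrefl fun T T' : Table S => T.Refines T' ∧ T ≠ T' := ⟨fun T h => h.2 rfl⟩
  exact Finite.wellFounded_of_trans_of_irrefl _

theorem State.merge_le {X : Set (State S)} {s : State S} (h : s ∈ X) : State.merge X ≤ s :=
  State.le_iff.2 ⟨fun _ => lowestE_le ⟨s, h, rfl⟩, fun _ => lowestP_le ⟨s, h, rfl⟩,
    fun _ _ hz => ⟨s, h, hz⟩⟩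

theorem State.le_merge {X : Set (State S)} {s : State S} (h : ∀ s' ∈ X, s ≤ s') :
    s ≤ State.merge X := by
  refine State.le_iff.2 ⟨fun x => le_lowestE ?_, fun l => le_lowestP ?_, ?_⟩
  · rintro _ ⟨s', h', rfl⟩; exact (State.le_iff.1 (h s' h')).1 x
  · rintro _ ⟨s', h', rfl⟩; exact (State.le_iff.1 (h s' h')).2.1 l
  · rintro x z ⟨s', h', hz⟩; exact (State.le_iff.1 (h s' h')).2.2 x z hz

theorem Result.meet_le {n : ℕ} {X : Set (Result n)} {r : Result n} (h : r ∈ X) :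
    Result.meet X ≤ r :=
  Result.le_iff.2 ⟨fun _ => ⟨lowestE_le ⟨r, h, rfl⟩, lowestP_le ⟨r, h, rfl⟩⟩,
    fun _ _ hr => ⟨r, h, hr⟩, fun hr => ⟨r, h, hr⟩, fun hr => ⟨r, h, hr⟩⟩

theorem Result.le_meet {n : ℕ} {X : Set (Result n)} {r : Result n} (h : ∀ r' ∈ X, r ≤ r') :
    r ≤ Result.meet X := by
  refine Result.le_iff.2 ⟨fun a => ⟨le_lowestE ?_, le_lowestP ?_⟩, ?_, ?_, ?_⟩
  · rintro _ ⟨r', h', rfl⟩; exact ((Result.le_iff.1 (h r' h')).1 a).1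
  · rintro _ ⟨r', h', rfl⟩; exact ((Result.le_iff.1 (h r' h')).1 a).2
  · rintro a c ⟨r', h', hr⟩; exact (Result.le_iff.1 (h r' h')).2.1 a c hr
  · rintro ⟨r', h', hr⟩; exact (Result.le_iff.1 (h r' h')).2.2.1 hr
  · rintro ⟨r', h', hr⟩; exact (Result.le_iff.1 (h r' h')).2.2.2 hr

/-! ### Monotonicity of the transfer functions -/

section Mono

variable {s s' : State S}

theorem State.Bad.anti (h : s ≤ s') {l : Loc S} (hb : s'.Bad l) : s.Bad l := by
  obtain ⟨h₁, h₂, -⟩ := State.le_iff.1 h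
  refine ⟨?_, PState.ne_clean_of_le (h₂ l) hb.2⟩
  cases l with
  | field x f => exact EState.eq_escaped_of_le (h₁ x) hb.1
  | elem a i => rfl
  | ptr x => rfl

theorem ptrPending.anti (h : s ≤ s') (hp : ptrPending s') : ptrPending s :=
  hp.imp fun _ hx => PState.ne_clean_of_le ((State.le_iff.1 h).2.1 _) hx

theorem State.published_anti (h : s ≤ s') (v : Val S) : s'.published v ⊆ s.published v := by
  rintro z ⟨x, hx, hz⟩
  exact ⟨x, hx, (State.le_iff.1 h).2.2 _ _ hz⟩

theorem touched_anti (h : s ≤ s') (i : Instr S) : touched i s' ⊆ touched i s := by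
  rintro l (hl | ⟨v, z, f, hv, hz, hl⟩)
  · exact .inl hl
  · exact .inr ⟨v, z, f, hv, State.published_anti h v hz, hl⟩

theorem State.setPers_mono (h : s ≤ s') (l : Loc S) (p : PState) :
    s.setPers l p ≤ s'.setPers l p := by
  obtain ⟨h₁, h₂, h₃⟩ := State.le_iff.1 h
  refine State.le_iff.2 ⟨h₁, fun l' => ?_, h₃⟩
  simp only [State.setPers]
  split_ifs
  · exact le_rfl
  · exact h₂ l'

theorem State.escapeVal_mono (h : s ≤ s') (v : Val S) : s.escapeVal v ≤ s'.escapeVal v := by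
  obtain ⟨h₁, h₂, h₃⟩ := State.le_iff.1 h
  refine State.le_iff.2 ⟨fun z => ?_, h₂, h₃⟩
  simp only [State.escapeVal]
  split_ifs with hz hz'
  · exact le_rfl
  · exact EState.escaped_le _
  · exact absurd (State.published_anti h v ‹_›) hz
  · exact h₁ z

theorem State.overwrite_mono (h : s ≤ s') (y : S.Var) (e : EState) :
    s.overwrite y e ≤ s'.overwrite y e := by
  obtain ⟨h₁, h₂, h₃⟩ := State.le_iff.1 h
  refine State.le_iff.2 ⟨fun z => ?_, h₂, fun x z => ?_⟩ <;> simp only [State.overwrite]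
  · split_ifs
    · exact le_rfl
    · exact h₁ z
  · split_ifs
    · exact id
    · exact fun hz => ⟨h₃ _ _ hz.1, hz.2⟩

theorem State.loadInto_mono (h : s ≤ s') (y : Option S.Var) : s.loadInto y ≤ s'.loadInto y := by
  cases y with
  | none => exact h
  | some y => exact State.overwrite_mono h y _

theorem State.allocVar_mono (h : s ≤ s') (x : S.Var) : s.allocVar x ≤ s'.allocVar x := by
  obtain ⟨h₁, -, h₃⟩ := State.le_iff.1 (State.overwrite_mono h x .captured)
  have h₂ := (State.le_iff.1 h).2.1
  refine State.le_iff.2 ⟨h₁, fun l => ?_, h₃⟩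
  cases l <;> simp only [State.allocVar]
  · split_ifs
    · exact le_rfl
    · exact h₂ _
  all_goals exact h₂ _

theorem State.copyVar_mono (h : s ≤ s') (y x : S.Var) : s.copyVar y x ≤ s'.copyVar y x := by
  obtain ⟨h₁, h₂, h₃⟩ := State.le_iff.1 h
  refine State.le_iff.2 ⟨fun z => ?_, h₂, fun z w => ?_⟩ <;> simp only [State.copyVar]
  · split_ifs
    · exact h₁ x
    · exact h₁ z
  · have hx := h₃ x z
    have hw := h₃ x w
    have hz := h₃ z w
    split_ifs <;> first | tauto | (simp only [Set.mem_union]; tauto)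

theorem State.resetIdx_mono (h : s ≤ s') (i : S.Idx) : s.resetIdx i ≤ s'.resetIdx i := by
  obtain ⟨h₁, h₂, h₃⟩ := State.le_iff.1 h
  refine State.le_iff.2 ⟨h₁, fun l => ?_, h₃⟩
  cases l <;> simp only [State.resetIdx]
  case elem =>
    split_ifs
    · exact le_rfl
    · exact h₂ _
  all_goals exact h₂ _

theorem State.doStore_mono (h : s ≤ s') (l : Loc S) (v : Val S) :
    s.doStore l v ≤ s'.doStore l v :=
  State.setPers_mono (State.escapeVal_mono h v) l _

theorem State.doLoad_mono (h : s ≤ s') (a : Bool) (y : Option S.Var) (l : Loc S) :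
    s.doLoad a y l ≤ s'.doLoad a y l := by
  refine State.loadInto_mono ?_ y
  split_ifs
  · exact State.setPers_mono h l _
  · exact h

theorem State.doClwb_pers (s : State S) (l l' : Loc S) :
    (s.doClwb l).pers l' = if l' = l ∧ s.pers l = .dirty then .clwb else s.pers l' := by
  unfold State.doClwb State.setPers
  grind

theorem State.doClwb_mono (h : s ≤ s') (l : Loc S) : s.doClwb l ≤ s'.doClwb l := by
  obtain ⟨h₁, h₂, h₃⟩ := State.le_iff.1 h
  refine State.le_iff.2 ⟨fun x => ?_, fun l' => ?_, fun x z => ?_⟩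
  · have := h₁ x
    unfold State.doClwb State.setPers
    split_ifs <;> exact this
  · have := h₂ l'
    rw [State.doClwb_pers, State.doClwb_pers]
    split_ifs with ha hb hb
    · exact le_rfl
    · obtain ⟨rfl, ha⟩ := ha
      cases hp : s'.pers l'
      · exact absurd ⟨rfl, hp⟩ hb
      · exact le_rfl
      · exact PState.le_clean _
    · obtain ⟨rfl, hb⟩ := hb
      rw [hb] at this
      exact absurd ⟨rfl, le_antisymm this (PState.dirty_le _)⟩ ha
    · exact this
  · have := h₃ x z
    unfold State.doClwb State.setPers
    split_ifs <;> exact this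

theorem State.doFence_mono (h : s ≤ s') : s.doFence ≤ s'.doFence := by
  obtain ⟨h₁, h₂, h₃⟩ := State.le_iff.1 h
  refine State.le_iff.2 ⟨h₁, fun l => ?_, h₃⟩
  have := h₂ l
  simp only [State.doFence]
  revert this
  cases s.pers l <;> cases s'.pers l <;> decide

theorem State.le_doFence (s : State S) : s ≤ s.doFence := by
  refine State.le_iff.2 ⟨fun _ => le_rfl, fun l => ?_, fun _ _ => id⟩
  simp only [State.doFence]
  split_ifs
  · exact PState.le_clean _
  · exact le_rfl

theorem State.callCtx_mono (h : s ≤ s') {n : ℕ} (args : Fin n → S.Var) :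
    s.callCtx args ≤ s'.callCtx args := by
  obtain ⟨h₁, h₂, -⟩ := State.le_iff.1 h
  refine fun i => ⟨h₁ _, le_lowestP ?_⟩
  rintro _ ⟨f, rfl⟩
  exact le_trans (lowestP_le (X := {p | ∃ f, p = s.pers (.field (args i) f)}) ⟨f, rfl⟩) (h₂ _)

theorem State.afterArgs_mono (h : s ≤ s') {n : ℕ} {r r' : Result n} (hr : r ≤ r')
    (args : Fin n → S.Var) : s.afterArgs r args ≤ s'.afterArgs r' args := by
  obtain ⟨h₁, h₂, h₃⟩ := State.le_iff.1 h
  obtain ⟨hst, hal, -, -⟩ := Result.le_iff.1 hr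
  have hals : ∀ x z, z ∈ (s'.afterArgs r' args).als x → z ∈ (s.afterArgs r args).als x := by
    rintro x z (hz | ⟨i, j, hij, hx, hz⟩)
    · exact .inl (h₃ _ _ hz)
    · exact .inr ⟨i, j, hal _ _ hij, h₃ _ _ hx, h₃ _ _ hz⟩
  refine State.le_iff.2 ⟨fun z => ?_, fun l => ?_, hals⟩
  · simp only [State.afterArgs] at hals ⊢
    split_ifs with c₁ c₂ c₃ c₄ c₅
    all_goals first
      | exact EState.escaped_le _
      | exact le_rfl
      | exact h₁ z
      | (obtain ⟨i, hi, hz⟩ := ‹∃ i, (r'.st (some i)).1 = .escaped ∧ _›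
         exact absurd ⟨i, EState.eq_escaped_of_le (hst _).1 hi, hz.imp_right (hals _ _)⟩ c₁)
  · cases l <;> simp only [State.afterArgs]
    case field z f =>
      split_ifs
      · refine le_lowestP ?_
        rintro _ ⟨i, hi, rfl⟩
        exact le_trans (lowestP_le (X := {p | ∃ i, z = args i ∧ p = (r.st (some i)).2})
          ⟨i, hi, rfl⟩) (hst _).2
      · exact h₂ _
    all_goals exact h₂ _

theorem State.afterRet_mono (h : s ≤ s') {n : ℕ} {r r' : Result n} (hr : r ≤ r')
    (args : Fin n → S.Var) (y : Option S.Var) :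
    s.afterRet r args y ≤ s'.afterRet r' args y := by
  obtain ⟨h₁, h₂, h₃⟩ := State.le_iff.1 h
  obtain ⟨hst, hal, -, -⟩ := Result.le_iff.1 hr
  cases y with
  | none => exact h
  | some y =>
    refine State.le_iff.2 ⟨fun z => ?_, fun l => ?_, fun x z => ?_⟩
    · simp only [State.afterRet]
      split_ifs
      · exact (hst _).1
      · exact h₁ z
    · cases l <;> simp only [State.afterRet]
      case field z f =>
        split_ifs
        · exact (hst _).2
        · exact h₂ _
      all_goals exact h₂ _
    · simp only [State.afterRet]
      split_ifs
      · rintro (hz | ⟨i, hi, hz⟩)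
        · exact .inl hz
        · exact .inr ⟨i, hal _ _ hi, h₃ _ _ hz⟩
      · rintro (⟨hne, hz⟩ | ⟨hz, i, hi, hx⟩)
        · exact .inl ⟨hne, h₃ _ _ hz⟩
        · exact .inr ⟨hz, i, hal _ _ hi, h₃ _ _ hx⟩

/-- If `i` is a call, then its summary in the first table and state lies below the one in the
second. -/
def CallLE (T T' : Table S) (i : Instr S) (s s' : State S) : Prop :=
  ∀ y g args, i = .call y g args → lookup T g (s.callCtx args) ≤ lookup T' g (s'.callCtx args)

variable {T T' : Table S} {i : Instr S}

theorem transfer_mono (h : s ≤ s') (hc : CallLE T T' i s s') :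
    transfer T i s ≤ transfer T' i s' := by
  cases i with
  | alloc x => exact State.allocVar_mono h x
  | copy y x => exact State.copyVar_mono h y x
  | setIdx j => exact State.resetIdx_mono h j
  | store l v => exact State.doStore_mono h l v
  | load a y l => exact State.doLoad_mono h a y l
  | rmw y l v => exact State.doStore_mono (State.doLoad_mono (State.doFence_mono h) _ y l) l v
  | flush l => exact State.setPers_mono h l _
  | clwb l => exact State.doClwb_mono h l
  | fence => exact State.doFence_mono h
  | volLoad y => exact State.loadInto_mono h _
  | volStore _ v => exact State.escapeVal_mono h v
  | unlock => exact h
  | call y g args =>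
    have hr := hc y g args rfl
    exact State.afterRet_mono (State.afterArgs_mono h hr args) hr args y
  | other => exact h

theorem secondBad.anti (h : s ≤ s') (hc : CallLE T T' i s s') (hb : secondBad T' i s') :
    secondBad T i s := by
  obtain ⟨l₁, l₂, hne, ht, h₁, h₂⟩ := hb
  exact ⟨l₁, l₂, hne, touched_anti h i ht, h₁.anti (transfer_mono h hc),
    h₂.anti (transfer_mono h hc)⟩

theorem marksDirEscAt.anti (h : s ≤ s') (hc : CallLE T T' i s s') (hm : marksDirEscAt T' i s') :
    marksDirEscAt T i s := by
  cases i
  case call y g args => exact (Result.le_iff.1 (hc y g args rfl)).2.2.1 hm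
  all_goals
    obtain ⟨l, hl, hb⟩ := hm
    exact ⟨l, touched_anti h _ hl, hb.anti (transfer_mono h hc)⟩

theorem marksRelAt.anti (hc : CallLE T T' i s s') (hm : marksRelAt T' i s') :
    marksRelAt T i s := by
  cases i
  case call y g args => exact (Result.le_iff.1 (hc y g args rfl)).2.2.2 hm
  all_goals exact hm

/-- A less precise state reports more violations. -/
theorem reportedAt.anti (h : s ≤ s') (hc : CallLE T T' i s s') (hr : reportedAt T' i s') :
    reportedAt T i s := by
  refine hr.imp (And.imp_right (ptrPending.anti h)) fun hr => ?_
  cases i with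
  | store l v => exact secondBad.anti h hc hr
  | rmw y l v => exact secondBad.anti h hc hr
  | volStore rel v =>
    exact hr.imp (secondBad.anti h hc)
      (And.imp_right (Exists.imp fun l => State.Bad.anti (State.escapeVal_mono h v)))
  | unlock => exact hr.imp fun l => State.Bad.anti h
  | call y g args =>
    obtain ⟨-, -, hd, hrel⟩ := Result.le_iff.1 (hc y g args rfl)
    exact ⟨hr.1.imp hd hrel, hr.2.imp fun l => And.imp_left (State.Bad.anti h)⟩
  | setIdx j => exact hr.imp fun a => PState.ne_clean_of_le ((State.le_iff.1 h).2.1 _)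
  | _ => exact hr

end Mono

/-! ### The summary table under the worklist algorithm -/

section Table

variable (P : Program S) (T : Table S) (F : S.Fn) (C : Ctx (S.arity F))

theorem updateTable_self :
    updateTable P T F C F C =
      some (Result.meet ({r | T F C = some r} ∪ {result P T F C})) := by
  simp [updateTable]

theorem updateTable_of_ne {F' : S.Fn} {C' : Ctx (S.arity F')}
    (h : (⟨F', C'⟩ : Pair S) ≠ ⟨F, C⟩) : updateTable P T F C F' C' = T F' C' := by
  by_cases hF : F' = F
  · subst hF
    have hC : C' ≠ C := fun hC => h (by rw [hC])
    simp [updateTable, hC]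
  · simp [updateTable, hF]

theorem updateTable_ne_none {q : Pair S} (h : T q.1 q.2 ≠ none) :
    updateTable P T F C q.1 q.2 ≠ none := by
  by_cases hq : q = ⟨F, C⟩
  · subst hq
    simp [updateTable_self]
  · rwa [updateTable_of_ne P T F C hq]

theorem updateTable_refines : (updateTable P T F C).Refines T := by
  intro F' C' r' h
  by_cases hq : (⟨F', C'⟩ : Pair S) = ⟨F, C⟩
  · cases hq
    exact ⟨_, updateTable_self P T F C, Result.meet_le (.inl h)⟩
  · exact ⟨r', by rw [updateTable_of_ne P T F C hq, h], le_rfl⟩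

theorem updateTable_eq_self (h : updateTable P T F C F C = T F C) :
    updateTable P T F C = T := by
  funext F' C'
  by_cases hq : (⟨F', C'⟩ : Pair S) = ⟨F, C⟩
  · cases hq
    exact h
  · exact updateTable_of_ne P T F C hq

end Table

/-- The pair has been analysed or is on the worklist. -/
def WState.Tracked (W : WState S) (q : Pair S) : Prop := W.table q.1 q.2 ≠ none ∨ q ∈ W.work

/-- Every processing order of the worklist comes to an end: a step either lowers the table or takes
a pair with an entry off the worklist, without adding such a pair. -/
theorem exists_work_eq_empty (P : Program S) (W : WState S) :
    ∃ W', Relation.ReflTransGen (WStep P) W W' ∧ W'.work = ∅ := by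
  obtain ⟨T, hT⟩ : ∃ T, T = W.table := ⟨_, rfl⟩
  induction T using Table.wellFounded_refines.induction generalizing W with
  | _ T ihT =>
  obtain ⟨n, hn⟩ : ∃ n, n = {q ∈ W.work | T q.1 q.2 ≠ none}.ncard := ⟨_, rfl⟩
  induction n using Nat.strong_induction_on generalizing W with
  | _ n ihn =>
  subst hT
  rcases W.work.eq_empty_or_nonempty with h | ⟨⟨F, C⟩, hq⟩
  · exact ⟨W, .refl, h⟩
  have hstep : WStep P W (process P W F C) := ⟨F, C, hq, rfl⟩
  have hfin : ∃ W', Relation.ReflTransGen (WStep P) (process P W F C) W' ∧ W'.work = ∅ := by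
    by_cases hch : updateTable P W.table F C F C = W.table F C
    -- Demanded pairs have no entry in the table, and callers are not pushed again.
    · have hT' := updateTable_eq_self P W.table F C hch
      refine ihn _ ?_ (process P W F C) hT'.symm rfl
      rw [hn]
      have hne : W.table F C ≠ none := by
        rw [← hch, updateTable_self]; simp
      refine Set.ncard_lt_ncard ?_ (Set.toFinite _)
      refine (Set.ssubset_iff_of_subset ?_).2 ⟨⟨F, C⟩, ⟨hq, hne⟩, ?_⟩
      · rintro q ⟨h | h | h, hqn⟩
        · exact ⟨h.1, hqn⟩
        · rw [hT'] at h
          exact absurd h.2 hqn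
        · exact absurd hch h.1
      · rintro ⟨h | h | h, -⟩
        · exact h.2 rfl
        · rw [hT'] at h
          exact hne h.2
        · exact h.1 hch
    · refine ihT _ ⟨updateTable_refines P W.table F C, fun h => hch ?_⟩ (process P W F C) rfl
      rw [h]
  obtain ⟨W', hW', hw⟩ := hfin
  exact ⟨W', .head hstep hW', hw⟩

theorem exists_outcome (P : Program S) : ∃ W, Outcome P W :=
  exists_work_eq_empty P (initW S)

theorem lookup_of_eq_some {T : Table S} {g : S.Fn} {c : Ctx (S.arity g)} {r : Result (S.arity g)}
    (h : T g c = some r) : lookup T g c = r := by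
  unfold lookup
  rw [h]

theorem lookup_congr {T T' : Table S} {g : S.Fn} (h : T g = T' g) (c : Ctx (S.arity g)) :
    lookup T g c = lookup T' g c := by
  unfold lookup
  rw [h]

section Congr

/-! The analysis of a function depends only on the table entries of the functions that it calls. -/

variable {P : Program S} {T T' : Table S} {F : S.Fn}

theorem transfer_congr (h : ∀ g, Calls P F g → T g = T' g) {b : S.Blk} {i : Instr S}
    (hi : i ∈ P.body F b) : transfer T i = transfer T' i := by
  funext s
  cases i
  case call y g args => simp only [transfer, lookup_congr (h g ⟨b, y, args, hi⟩)]
  all_goals rfl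

theorem transferList_congr (h : ∀ g, Calls P F g → T g = T' g) {b : S.Blk} {is : List (Instr S)}
    (his : is ⊆ P.body F b) : transferList T is = transferList T' is := by
  funext s
  induction is generalizing s with
  | nil => rfl
  | cons i is ih =>
    have hi := his List.mem_cons_self
    simp only [transferList, List.foldl_cons, transfer_congr h hi] at ih ⊢
    exact ih (fun j hj => his (List.mem_cons_of_mem _ hj)) _

theorem iter_congr (h : ∀ g, Calls P F g → T g = T' g) (C : Ctx (S.arity F)) (k : ℕ) :
    iter P T F C k = iter P T' F C k := by
  induction k with
  | zero => rfl
  | succ k ih =>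
    funext b
    simp only [iter, ih, transferList_congr h (List.Subset.refl _)]

theorem stateAt_congr (h : ∀ g, Calls P F g → T g = T' g) (C : Ctx (S.arity F)) :
    stateAt P T F C = stateAt P T' F C := by
  funext b k
  simp only [stateAt, solve, iter_congr h, transferList_congr h (List.take_subset _ _)]

theorem demands_congr (h : ∀ g, Calls P F g → T g = T' g) (C : Ctx (S.arity F)) :
    Demands P T F C = Demands P T' F C := by
  simp only [Demands, InstrAt, stateAt_congr h C, funext_iff, implies_true]

theorem result_congr (h : ∀ g, Calls P F g → T g = T' g) (C : Ctx (S.arity F)) :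
    result P T F C = result P T' F C := by
  have hd : ∀ b k i s, InstrAt P T' F C b k i s →
      (marksDirEscAt T i s ↔ marksDirEscAt T' i s) := by
    intro b k i s hi
    have hm := List.mem_of_getElem? hi.1
    have ht := transfer_congr h hm
    cases i
    case call y g args => simp only [marksDirEscAt, lookup_congr (h g ⟨b, y, args, hm⟩)]
    all_goals simp only [marksDirEscAt, ht]
  have hr : ∀ b k i s, InstrAt P T' F C b k i s → (marksRelAt T i s ↔ marksRelAt T' i s) := by
    intro b k i s hi
    have hm := List.mem_of_getElem? hi.1
    cases i
    case call y g args => simp only [marksRelAt, lookup_congr (h g ⟨b, y, args, hm⟩)]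
    all_goals exact Iff.rfl
  have hi : InstrAt P T F C = InstrAt P T' F C := by
    funext b k i s
    simp only [InstrAt, stateAt_congr h C]
  have he : ExitAt P T F C = ExitAt P T' F C := by
    funext b v s
    simp only [ExitAt, stateAt_congr h C]
  simp only [result, he, hi, Result.mk.injEq, true_and]
  constructor
  · exact propext (exists_congr fun b => exists_congr fun k => exists_congr fun i =>
      exists_congr fun s => and_congr_right (hd b k i s))
  · exact propext (exists_congr fun b => exists_congr fun k => exists_congr fun i =>
      exists_congr fun s => and_congr_right (hr b k i s))

end Congr

theorem WState.Tracked.process {P : Program S} {W : WState S} {q : Pair S} (h : W.Tracked q)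
    (F : S.Fn) (C : Ctx (S.arity F)) : (process P W F C).Tracked q := by
  rcases h with h | h
  · exact .inl (updateTable_ne_none P W.table F C h)
  · by_cases hq : q = ⟨F, C⟩
    · subst hq
      exact .inl (by simp [PMRobust.process, updateTable_self])
    · exact .inr (.inl ⟨h, hq⟩)

/-- A table that is closed under the analysis: its entries lie below the results of the analysis
that uses it, and it has an entry for every calling context that this analysis reaches. -/
def Table.Closed (P : Program S) (T : Table S) : Prop :=
  ∀ F C r, T F C = some r →
    r ≤ result P T F C ∧ ∀ q, Demands P T F C q → T q.1 q.2 ≠ none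

/-- Pairs that have been analysed and are not on the worklist are up to date, since a change of the
summary of a function puts all its callers back on the worklist. -/
theorem Run.upToDate {P : Program S} {W : WState S} (h : Run P W) :
    ∀ F C r, W.table F C = some r → (⟨F, C⟩ : Pair S) ∉ W.work →
      r ≤ result P W.table F C ∧ ∀ q, Demands P W.table F C q → W.Tracked q := by
  induction h with
  | refl => intro F C r h; cases h
  | @tail W _ _ hstep ih =>
    obtain ⟨F, C, -, rfl⟩ := hstep
    intro F₀ C₀ r hr hw
    -- If the entry has changed, then `F₀` does not call `F`, else it would be on the worklist.
    have hcalls : ∀ g, Calls P F₀ g → (process P W F C).table g = W.table g := by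
      intro g hg
      by_cases hch : updateTable P W.table F C F C = W.table F C
      · exact congrFun (updateTable_eq_self P W.table F C hch) g
      · have hgF : g ≠ F := by
          rintro rfl
          refine hw (.inr (.inr ⟨hch, ?_, hg⟩))
          change (process P W g C).table F₀ C₀ ≠ none
          rw [hr]; simp
        funext c
        exact updateTable_of_ne P W.table F C (fun hq => hgF (congrArg Sigma.fst hq))
    rw [result_congr hcalls, demands_congr hcalls]
    by_cases hq : (⟨F₀, C₀⟩ : Pair S) = ⟨F, C⟩
    · cases hq
      have hr' : some _ = some r := (updateTable_self P W.table F C).symm.trans hr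
      cases hr'
      refine ⟨Result.meet_le (.inr rfl), fun q hd => ?_⟩
      by_cases hn : updateTable P W.table F C q.1 q.2 = none
      · exact .inr (.inr (.inl ⟨hd, hn⟩))
      · exact .inl hn
    · have hr' : W.table F₀ C₀ = some r := (updateTable_of_ne P W.table F C hq).symm.trans hr
      obtain ⟨h₁, h₂⟩ := ih F₀ C₀ r hr' fun h => hw (.inl ⟨h, hq⟩)
      exact ⟨h₁, fun q hd => (h₂ q hd).process F C⟩

theorem Run.tracked_init {P : Program S} {W : WState S} (h : Run P W) {q : Pair S}
    (hq : q ∈ (initW S).work) : W.Tracked q := by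
  induction h with
  | refl => exact .inr hq
  | tail _ hstep ih =>
    obtain ⟨F, C, -, rfl⟩ := hstep
    exact ih.process F C

theorem Outcome.table_ne_none {P : Program S} {W : WState S} (h : Outcome P W) {q : Pair S}
    (hq : W.Tracked q) : W.table q.1 q.2 ≠ none :=
  hq.resolve_right (by simp [h.2])

theorem Outcome.closed {P : Program S} {W : WState S} (h : Outcome P W) :
    W.table.Closed P := by
  intro F C r hr
  obtain ⟨h₁, h₂⟩ := h.1.upToDate F C r hr (by simp [h.2])
  exact ⟨h₁, fun q hq => h.table_ne_none (h₂ q hq)⟩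

/-! ### The fixed point of the dataflow iteration -/

theorem mergeOpt_of_mem {X : Set (State S)} {s : State S} (h : s ∈ X) :
    ∃ s', mergeOpt X = some s' ∧ s' ≤ s :=
  ⟨State.merge X, if_pos ⟨s, h⟩, State.merge_le h⟩

theorem mergeOpt_eq_some {X : Set (State S)} {s : State S} (h : mergeOpt X = some s) :
    X.Nonempty ∧ s = State.merge X := by
  unfold mergeOpt at h
  split_ifs at h with hX
  exact ⟨hX, (Option.some.inj h).symm⟩

/-- A partial state that exists and lies below each state of a set exists and lies below their
merge, if there is one. -/
theorem le_mergeOpt {X : Set (State S)} {s' : State S} {o : Option (State S)}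
    (h : ∀ s' ∈ X, ∃ s, o = some s ∧ s ≤ s') (hX : mergeOpt X = some s') :
    ∃ s, o = some s ∧ s ≤ s' := by
  obtain ⟨⟨s₀, h₀⟩, rfl⟩ := mergeOpt_eq_some hX
  obtain ⟨s, rfl, -⟩ := h s₀ h₀
  refine ⟨s, rfl, State.le_merge fun s' hs' => ?_⟩
  obtain ⟨t, ht, hle⟩ := h s' hs'
  cases ht
  exact hle

section Solve

variable {P : Program S} {T : Table S} {F : S.Fn} {C : Ctx (S.arity F)}

theorem iter_antitone {k n : ℕ} (hkn : k ≤ n) {b : S.Blk} {s : State S}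
    (h : iter P T F C k b = some s) : ∃ s', iter P T F C n b = some s' ∧ s' ≤ s := by
  induction hkn with
  | refl => exact ⟨s, h, le_rfl⟩
  | @step n _ ih =>
    obtain ⟨s', hs', hle⟩ := ih
    have hmem : s' ∈ {s | iter P T F C n b = some s} := hs'
    obtain ⟨s'', hs'', hle'⟩ := mergeOpt_of_mem (Set.mem_union_left _ hmem)
    exact ⟨s'', hs'', hle'.trans hle⟩

theorem solve_le_iter {k : ℕ} {b : S.Blk} {s : State S} (h : iter P T F C k b = some s) :
    ∃ s', solve P T F C b = some s' ∧ s' ≤ s :=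
  mergeOpt_of_mem (X := {s | ∃ k, iter P T F C k b = some s}) ⟨k, h⟩

/-- The descending iteration becomes stationary, as there are finitely many states. -/
theorem exists_iter_eq_solve {b : S.Blk} {s : State S} (h : solve P T F C b = some s) :
    ∃ k, iter P T F C k b = some s := by
  obtain ⟨hX, rfl⟩ := mergeOpt_eq_some h
  obtain ⟨m, ⟨k, hk⟩, hmin⟩ := (Set.toFinite _).exists_minimal hX
  suffices hm : m = State.merge {s | ∃ k, iter P T F C k b = some s} from ⟨k, hm ▸ hk⟩
  refine le_antisymm (State.le_merge ?_) (State.merge_le ⟨k, hk⟩)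
  rintro s ⟨n, hn⟩
  obtain ⟨t, ht, htm⟩ := iter_antitone (le_max_left k n) hk
  obtain ⟨t', ht', hts⟩ := iter_antitone (le_max_right k n) hn
  rw [ht] at ht'
  cases ht'
  exact (hmin ⟨_, ht⟩ htm).trans hts

theorem solve_entry :
    ∃ s, solve P T F C (P.entry F) = some s ∧ s ≤ entryState P F C := by
  obtain ⟨s, hs, hle⟩ := mergeOpt_of_mem
    (X := {s | P.entry F = P.entry F ∧ s = entryState P F C}) ⟨rfl, rfl⟩
  obtain ⟨s', hs', hle'⟩ := solve_le_iter (k := 0) (P := P) (T := T) (F := F) (C := C) hs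
  exact ⟨s', hs', hle'.trans hle⟩

theorem solve_jump {b b' : S.Blk} {succs : Set S.Blk} {s' : State S}
    (ht : P.term F b' = .jump succs) (hb : b ∈ succs) (h : solve P T F C b' = some s') :
    ∃ s, solve P T F C b = some s ∧ s ≤ transferList T (P.body F b') s' := by
  obtain ⟨k, hk⟩ := exists_iter_eq_solve h
  obtain ⟨s, hs, hle⟩ := mergeOpt_of_mem
    (X := {s | iter P T F C k b = some s} ∪ {s | ∃ b' succs s', P.term F b' = .jump succs ∧
      b ∈ succs ∧ iter P T F C k b' = some s' ∧ s = transferList T (P.body F b') s'})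
    (.inr ⟨b', succs, s', ht, hb, hk, rfl⟩)
  obtain ⟨t, ht, hle'⟩ := solve_le_iter (k := k + 1) hs
  exact ⟨t, ht, hle'.trans hle⟩

end Solve

/-! ### Lists of instructions with inserted fences -/

open Classical in
/-- The state after an optional fence. -/
noncomputable def State.fenceIf (p : Prop) (s : State S) : State S := if p then s.doFence else s

theorem State.le_fenceIf (p : Prop) (s : State S) : s ≤ s.fenceIf p := by
  unfold State.fenceIf
  split_ifs
  · exact s.le_doFence
  · exact le_rfl

theorem State.fenceIf_pers_dirty {p : Prop} {s : State S} {l : Loc S}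
    (h : (s.fenceIf p).pers l = .dirty) : s.pers l = .dirty := by
  unfold State.fenceIf State.doFence at h
  grind

theorem State.fenceIf_pers_ne_clwb {p : Prop} (hp : p) (s : State S) (l : Loc S) :
    (s.fenceIf p).pers l ≠ .clwb := by
  unfold State.fenceIf State.doFence
  grind

theorem State.fenceIf_of_not {p : Prop} (hp : ¬ p) (s : State S) : s.fenceIf p = s := if_neg hp

/-- The program with a fence before each position in a set of positions. -/
noncomputable def fenceWith (P : Program S) (p : S.Fn → S.Blk → ℕ → Prop) : Program S :=
  { P with body := fun F b => fenceList (p F b) (P.body F b) }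

theorem fenceList_false (is : List (Instr S)) : fenceList (fun _ => False) is = is := by
  induction is with
  | nil => simp [fenceList]
  | cons i is ih => simp [fenceList, ih]

theorem fenceWith_false (P : Program S) : fenceWith P (fun _ _ _ => False) = P := by
  simp only [fenceWith, fenceList_false]

theorem transferList_cons (T : Table S) (i : Instr S) (is : List (Instr S)) (s : State S) :
    transferList T (i :: is) s = transferList T is (transfer T i s) := rfl

theorem transferList_take_succ (T : Table S) {is : List (Instr S)} {k : ℕ} {i : Instr S}
    (h : is[k]? = some i) (s : State S) :
    transferList T (is.take (k + 1)) s = transfer T i (transferList T (is.take k) s) := by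
  simp [transferList, List.take_add_one, h]

/-- Invariants of the states at the positions of a list carry over to the list with inserted
fences, with the state before the optional fence. -/
theorem fenceList_trace (T : Table S) {p : ℕ → Prop} {is : List (Instr S)}
    {I : ℕ → State S → Prop} {s : State S} (h₀ : I 0 s)
    (hI : ∀ k i u, is[k]? = some i → I k u → I (k + 1) (transfer T i (u.fenceIf (p k)))) :
    (∀ k' i, (fenceList p is)[k']? = some i → i = .fence ∨
      ∃ k u, is[k]? = some i ∧ I k u ∧
        transferList T ((fenceList p is).take k') s = u.fenceIf (p k)) ∧
    ∃ u, I is.length u ∧ transferList T (fenceList p is) s = u.fenceIf (p is.length) := by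
  induction is generalizing p I s with
  | nil =>
    by_cases hp : p 0
    · refine ⟨fun k' i h => .inl ?_, s, h₀, ?_⟩
      · cases k' <;> simp_all [fenceList]
      · simp [fenceList, hp, State.fenceIf, transferList, transfer]
    · refine ⟨fun k' i h => ?_, s, h₀, ?_⟩
      · simp [fenceList, hp] at h
      · simp [fenceList, hp, State.fenceIf, transferList]
  | cons j is ih =>
    have h₁ : I 1 (transfer T j (s.fenceIf (p 0))) := hI 0 j s rfl h₀
    obtain ⟨ih₁, ih₂⟩ := ih (p := fun k => p (k + 1)) (I := fun k => I (k + 1)) h₁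
      (fun k i u hi hu => hI (k + 1) i u (by simpa using hi) hu)
    by_cases hp : p 0
    · have hl : fenceList p (j :: is) = .fence :: j :: fenceList (fun k => p (k + 1)) is := by
        simp [fenceList, hp]
      have hf : transfer T .fence s = s.fenceIf (p 0) := by simp [transfer, State.fenceIf, hp]
      rw [hl]
      refine ⟨fun k' i h => ?_, ?_⟩
      · match k' with
        | 0 => exact .inl (by simpa using h.symm)
        | 1 => exact .inr ⟨0, s, by simpa using h, h₀, hf⟩
        | k' + 2 =>
          refine (ih₁ k' i (by simpa using h)).imp_right ?_
          rintro ⟨k, u, hk, hu, ht⟩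
          refine ⟨k + 1, u, by simpa using hk, hu, ?_⟩
          rw [← ht, List.take_succ_cons, List.take_succ_cons, transferList_cons,
            transferList_cons, hf]
      · obtain ⟨u, hu, ht⟩ := ih₂
        exact ⟨u, hu, by rw [transferList_cons, transferList_cons, hf, ht]; rfl⟩
    · have hl : fenceList p (j :: is) = j :: fenceList (fun k => p (k + 1)) is := by
        simp [fenceList, hp]
      rw [hl]
      have hf := s.fenceIf_of_not hp
      refine ⟨fun k' i h => ?_, ?_⟩
      · match k' with
        | 0 => exact .inr ⟨0, s, by simpa using h, h₀, hf.symm⟩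
        | k' + 1 =>
          refine (ih₁ k' i (by simpa using h)).imp_right ?_
          rintro ⟨k, u, hk, hu, ht⟩
          refine ⟨k + 1, u, by simpa using hk, hu, ?_⟩
          rw [← ht, List.take_succ_cons, transferList_cons, hf]
      · obtain ⟨u, hu, ht⟩ := ih₂
        rw [hf] at ht
        exact ⟨u, hu, by rw [transferList_cons, ht]; rfl⟩

/-! ### Comparison of a fenced program with a completed analysis of the original -/

/-- Each entry of `T` lies below all entries of `T'` for the same function and higher contexts. -/
def Table.Below (T T' : Table S) : Prop :=
  ∀ F C C' r r', C ≤ C' → T F C = some r → T' F C' = some r' → r ≤ r'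

theorem Table.Below.le_lookup {T T' : Table S} (h : T.Below T') {g : S.Fn}
    {c c' : Ctx (S.arity g)} {r : Result (S.arity g)} (hc : c ≤ c') (hr : T g c = some r) :
    r ≤ lookup T' g c' := by
  unfold lookup
  split
  · next r' hr' => exact h g c c' r r' hc hr hr'
  · refine Result.le_meet ?_
    rintro r' ⟨c'', hc'', hr'⟩
    exact h g c c'' r r' (hc.trans hc'') hr hr'

theorem entryState_mono (P : Program S) (F : S.Fn) {C C' : Ctx (S.arity F)} (h : C ≤ C') :
    entryState P F C ≤ entryState P F C' := by
  refine State.le_iff.2 ⟨fun x => le_lowestE ?_, fun l => ?_, fun _ _ => id⟩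
  · rintro _ ⟨i, hi, rfl⟩
    exact le_trans (lowestE_le (X := {e | ∃ i, P.params F i = x ∧ e = (C i).1}) ⟨i, hi, rfl⟩)
      (h i).1
  · cases l with
    | field x f =>
      refine le_lowestP ?_
      rintro _ ⟨i, hi, rfl⟩
      exact le_trans (lowestP_le (X := {p | ∃ i, P.params F i = x ∧ p = (C i).2}) ⟨i, hi, rfl⟩)
        (h i).2
    | _ => exact le_rfl

section Compare

variable {P : Program S} {T T' : Table S} {p : S.Fn → S.Blk → ℕ → Prop} {F : S.Fn}
  {C C' : Ctx (S.arity F)}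

/-- At the same instruction, reached in the analysis with a closed table, a higher state uses a
higher summary. -/
theorem Table.Closed.callLE (hT : T.Closed P) (hTT' : T.Below T') (hC : T F C ≠ none) {b : S.Blk}
    {k : ℕ} {i : Instr S} {s s' : State S} (hi : InstrAt P T F C b k i s) (h : s ≤ s') :
    CallLE T T' i s s' := by
  rintro y g args rfl
  obtain ⟨r, hr⟩ := Option.ne_none_iff_exists'.1 hC
  obtain ⟨r', hr'⟩ := Option.ne_none_iff_exists'.1
    ((hT F C r hr).2 ⟨g, s.callCtx args⟩ ⟨b, k, y, g, args, s, hi, rfl⟩)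
  rw [lookup_of_eq_some hr']
  exact hTT'.le_lookup (State.callCtx_mono h args) hr'

theorem block_compare (hT : T.Closed P) (hTT' : T.Below T') (hC : T F C ≠ none) {b : S.Blk}
    {s s' : State S} (hs : solve P T F C b = some s) (h : s ≤ s') :
    (∀ k' i, ((fenceWith P p).body F b)[k']? = some i → i = .fence ∨
      ∃ k u, (P.body F b)[k]? = some i ∧ transferList T ((P.body F b).take k) s ≤ u ∧
        transferList T' (((fenceWith P p).body F b).take k') s' = u.fenceIf (p F b k)) ∧
    ∃ u, transferList T ((P.body F b).take (P.body F b).length) s ≤ u ∧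
      transferList T' ((fenceWith P p).body F b) s' = u.fenceIf (p F b (P.body F b).length) := by
  refine fenceList_trace T' (I := fun k u => transferList T ((P.body F b).take k) s ≤ u) h ?_
  intro k i u hi hu
  have hle := hu.trans (u.le_fenceIf (p F b k))
  rw [transferList_take_succ T hi]
  exact transfer_mono hle (hT.callLE hTT' hC ⟨hi, by simp [stateAt, hs]⟩ hle)

theorem iter_compare (hT : T.Closed P) (hTT' : T.Below T') (hC : T F C ≠ none) (hCC' : C ≤ C')
    (n : ℕ) {b : S.Blk} {s' : State S} (h : iter (fenceWith P p) T' F C' n b = some s') :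
    ∃ s, solve P T F C b = some s ∧ s ≤ s' := by
  induction n generalizing b s' with
  | zero =>
    refine le_mergeOpt ?_ h
    rintro s' ⟨rfl, rfl⟩
    obtain ⟨s, hs, hle⟩ := solve_entry (P := P) (T := T) (F := F) (C := C)
    exact ⟨s, hs, hle.trans (entryState_mono P F hCC')⟩
  | succ n ih =>
    refine le_mergeOpt ?_ h
    rintro s' (hs' | ⟨b', succs, t', ht, hb, ht', rfl⟩)
    · exact ih hs'
    · obtain ⟨t, hs, hle⟩ := ih ht'
      obtain ⟨s, hs', hle'⟩ := solve_jump (P := P) ht hb hs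
      obtain ⟨u, hu, hu'⟩ := (block_compare (p := p) hT hTT' hC hs hle).2
      refine ⟨s, hs', hle'.trans ?_⟩
      rw [List.take_length] at hu
      rw [hu']
      exact hu.trans (u.le_fenceIf _)

theorem solve_compare (hT : T.Closed P) (hTT' : T.Below T') (hC : T F C ≠ none) (hCC' : C ≤ C')
    {b : S.Blk} {s' : State S} (h : solve (fenceWith P p) T' F C' b = some s') :
    ∃ s, solve P T F C b = some s ∧ s ≤ s' :=
  le_mergeOpt (by rintro _ ⟨n, hn⟩; exact iter_compare hT hTT' hC hCC' n hn) h

/-- A reached instruction of the fenced program is an inserted fence, or it is reached in the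
original program, in a lower state than the one before the optional fence. -/
theorem InstrAt.compare (hT : T.Closed P) (hTT' : T.Below T') (hC : T F C ≠ none) (hCC' : C ≤ C')
    {b : S.Blk} {k' : ℕ} {i : Instr S} {s' : State S}
    (h : InstrAt (fenceWith P p) T' F C' b k' i s') :
    i = .fence ∨ ∃ k s u, InstrAt P T F C b k i s ∧ s ≤ u ∧ s' = u.fenceIf (p F b k) := by
  obtain ⟨hi, hs'⟩ := h
  obtain ⟨t', ht', rfl⟩ := Option.map_eq_some_iff.1 hs'
  obtain ⟨t, ht, hle⟩ := solve_compare hT hTT' hC hCC' ht'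
  refine ((block_compare hT hTT' hC ht hle).1 k' i hi).imp_right ?_
  rintro ⟨k, u, hk, hu, he⟩
  exact ⟨k, _, u, ⟨hk, by simp [stateAt, ht]⟩, hu, he⟩

theorem stateAt_length_compare (hT : T.Closed P) (hTT' : T.Below T') (hC : T F C ≠ none)
    (hCC' : C ≤ C') {b : S.Blk} {s' : State S}
    (h : stateAt (fenceWith P p) T' F C' b ((fenceWith P p).body F b).length = some s') :
    ∃ s u, stateAt P T F C b (P.body F b).length = some s ∧ s ≤ u ∧
      s' = u.fenceIf (p F b (P.body F b).length) := by
  obtain ⟨t', ht', rfl⟩ := Option.map_eq_some_iff.1 h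
  obtain ⟨t, ht, hle⟩ := solve_compare hT hTT' hC hCC' ht'
  obtain ⟨u, hu, he⟩ := (block_compare (p := p) hT hTT' hC ht hle).2
  exact ⟨_, u, by simp only [stateAt, ht, Option.map_some], hu, by rw [List.take_length, he]⟩

theorem ExitAt.compare (hT : T.Closed P) (hTT' : T.Below T') (hC : T F C ≠ none) (hCC' : C ≤ C')
    {b : S.Blk} {v : Option S.Var} {s' : State S} (h : ExitAt (fenceWith P p) T' F C' b v s') :
    ∃ s u, ExitAt P T F C b v s ∧ s ≤ u ∧ s' = u.fenceIf (p F b (P.body F b).length) := by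
  obtain ⟨s, u, hs, hle, he⟩ := stateAt_length_compare hT hTT' hC hCC' h.2
  exact ⟨s, u, ⟨h.1, hs⟩, hle, he⟩

theorem result_compare (hT : T.Closed P) (hTT' : T.Below T') (hC : T F C ≠ none) (hCC' : C ≤ C') :
    result P T F C ≤ result (fenceWith P p) T' F C' := by
  have hexit : ∀ {b v s'}, ExitAt (fenceWith P p) T' F C' b v s' →
      ∃ s, ExitAt P T F C b v s ∧ s ≤ s' := by
    intro b v s' h
    obtain ⟨s, u, hs, hle, rfl⟩ := h.compare hT hTT' hC hCC'
    exact ⟨s, hs, hle.trans (u.le_fenceIf _)⟩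
  have hinstr : ∀ {b k' i s'}, InstrAt (fenceWith P p) T' F C' b k' i s' → i ≠ .fence →
      ∃ k s, InstrAt P T F C b k i s ∧ s ≤ s' ∧ CallLE T T' i s s' := by
    intro b k' i s' h hne
    obtain ⟨k, s, u, hs, hle, rfl⟩ := (h.compare hT hTT' hC hCC').resolve_left hne
    have hle' := hle.trans (u.le_fenceIf (p F b k))
    exact ⟨k, s, hs, hle', hT.callLE hTT' hC hs hle'⟩
  refine Result.le_iff.2 ⟨fun a => ⟨le_lowestE ?_, le_lowestP ?_⟩, ?_, ?_, ?_⟩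
  · rintro _ ⟨b, v, s', x, he, hx, rfl⟩
    obtain ⟨s, hs, hle⟩ := hexit he
    exact le_trans (lowestE_le (X := {e | ∃ b v s x, ExitAt P T F C b v s ∧
      slot P F v a = some x ∧ e = s.esc x}) ⟨b, v, s, x, hs, hx, rfl⟩) ((State.le_iff.1 hle).1 x)
  · rintro _ ⟨b, v, s', x, f, he, hx, rfl⟩
    obtain ⟨s, hs, hle⟩ := hexit he
    exact le_trans (lowestP_le (X := {q | ∃ b v s x f, ExitAt P T F C b v s ∧
      slot P F v a = some x ∧ q = s.pers (.field x f)}) ⟨b, v, s, x, f, hs, hx, rfl⟩)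
      ((State.le_iff.1 hle).2.1 _)
  · rintro a c ⟨b, v, s', x, y, he, hx, hy, hal⟩
    obtain ⟨s, hs, hle⟩ := hexit he
    exact ⟨b, v, s, x, y, hs, hx, hy, (State.le_iff.1 hle).2.2 _ _ hal⟩
  · rintro ⟨b, k', i, s', hi, hm⟩
    obtain ⟨k, s, hs, hle, hc⟩ := hinstr hi (by
      rintro rfl
      obtain ⟨l, hl | ⟨v, z, f, hv, -⟩, -⟩ := hm
      · cases hl
      · cases hv)
    exact ⟨b, k, i, s, hs, hm.anti hle hc⟩
  · rintro ⟨b, k', i, s', hi, hm⟩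
    obtain ⟨k, s, hs, hle, hc⟩ := hinstr hi (by rintro rfl; exact hm)
    exact ⟨b, k, i, s, hs, hm.anti hc⟩

end Compare

/-- At every stage of every run on the fenced program, the table lies above the table of a completed
run on the original program, and so do the contexts that come up. -/
theorem Run.compare {P : Program S} {W : WState S} (hW : Outcome P W)
    {p : S.Fn → S.Blk → ℕ → Prop} {W' : WState S} (h : Run (fenceWith P p) W') :
    W.table.Below W'.table ∧
      ∀ q, W'.Tracked q → ∃ C, C ≤ q.2 ∧ W.table q.1 C ≠ none := by
  have hcl := hW.closed
  induction h with
  | refl =>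
    refine ⟨fun F C C' r r' _ _ h => (by cases h), ?_⟩
    rintro q (hq | hq)
    · exact absurd rfl hq
    · exact ⟨q.2, le_rfl, hW.table_ne_none (hW.1.tracked_init hq)⟩
  | @tail W' _ _ hstep ih =>
    obtain ⟨F, C', hF, rfl⟩ := hstep
    obtain ⟨hb, hd⟩ := ih
    have htracked : ∀ q, updateTable (fenceWith P p) W'.table F C' q.1 q.2 ≠ none →
        W'.Tracked q := by
      intro q h
      by_cases hq : q = ⟨F, C'⟩
      · exact .inr (hq ▸ hF)
      · exact .inl (by rwa [updateTable_of_ne _ _ _ _ hq] at h)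
    refine ⟨fun F₁ C C₁ r r' hC hr hr' => ?_, ?_⟩
    · by_cases hq : (⟨F₁, C₁⟩ : Pair S) = ⟨F, C'⟩
      · cases hq
        have hr'' := (updateTable_self (fenceWith P p) W'.table F C').symm.trans hr'
        cases hr''
        refine Result.le_meet ?_
        rintro r' (h | rfl)
        · exact hb F C C' r r' hC hr h
        · exact (hcl F C r hr).1.trans (result_compare hcl hb (by simp [hr]) hC)
      · exact hb F₁ C C₁ r r' hC hr
          ((updateTable_of_ne (fenceWith P p) W'.table F C' hq).symm.trans hr')
    · rintro q (h | h | ⟨⟨b, k, y, g, args, s', hi, rfl⟩, -⟩ | ⟨-, h, -⟩)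
      · exact hd q (htracked q h)
      · exact hd q (.inr h.1)
      · obtain ⟨C, hC, hne⟩ := hd ⟨F, C'⟩ (.inr hF)
        obtain ⟨k, s, u, hs, hle, rfl⟩ :=
          (hi.compare hcl hb hne hC).resolve_left (by rintro ⟨⟩)
        obtain ⟨r, hr⟩ := Option.ne_none_iff_exists'.1 hne
        exact ⟨s.callCtx args, State.callCtx_mono (hle.trans (u.le_fenceIf _)) args,
          (hcl F C r hr).2 ⟨g, s.callCtx args⟩ ⟨b, k, y, g, args, s, hs, rfl⟩⟩
      · exact hd q (htracked q h)

/-! ### Absence of dirty locations after flush insertion -/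

/-- Every instruction that dirties a location is followed by a `clwb` of that location. -/
def Flushed (is : List (Instr S)) : Prop :=
  ∀ k i l, is[k]? = some i → i.dirties = some l → is[k + 1]? = some (.clwb l)

theorem flushed_flatMap (is : List (Instr S)) :
    Flushed (is.flatMap fun i => i :: (i.dirties.map Instr.clwb).toList) := by
  induction is with
  | nil => intro k i l h; simp at h
  | cons j is ih =>
    intro k i l hk hl
    rw [List.flatMap_cons] at hk ⊢
    cases hj : j.dirties with
    | none =>
      simp only [hj, Option.map_none, Option.toList_none, List.cons_append, List.nil_append]
        at hk ⊢
      match k with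
      | 0 =>
        rw [List.getElem?_cons_zero, Option.some.injEq] at hk
        rw [← hk, hj] at hl
        cases hl
      | k + 1 => exact ih k i l hk hl
    | some l' =>
      simp only [hj, Option.map_some, Option.toList_some, List.cons_append, List.nil_append]
        at hk ⊢
      match k with
      | 0 =>
        rw [List.getElem?_cons_zero, Option.some.injEq] at hk
        rw [← hk, hj] at hl
        cases hl
        rfl
      | 1 =>
        simp only [List.getElem?_cons_succ, List.getElem?_cons_zero, Option.some.injEq] at hk
        rw [← hk] at hl
        cases hl
      | k + 2 => exact ih k i l hk hl

/-- No state in the result is dirty. -/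
def Result.NoDirty {n : ℕ} (r : Result n) : Prop := ∀ a, (r.st a).2 ≠ .dirty

/-- No summary in the table contains a dirty state. -/
def Table.NoDirty (T : Table S) : Prop := ∀ F C r, T F C = some r → r.NoDirty

/-- No location is dirty. -/
def State.NoDirty (s : State S) : Prop := ∀ l, s.pers l ≠ .dirty

theorem Result.NoDirty.meet {n : ℕ} {X : Set (Result n)} (h : ∀ r ∈ X, r.NoDirty) :
    (Result.meet X).NoDirty := by
  intro a
  refine lowestP_ne_dirty ?_
  rintro _ ⟨r, hr, rfl⟩
  exact h r hr a

theorem Table.NoDirty.lookup {T : Table S} (h : T.NoDirty) (g : S.Fn) (c : Ctx (S.arity g)) :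
    (lookup T g c).NoDirty := by
  unfold PMRobust.lookup
  split
  · next r hr => exact h g c r hr
  · refine Result.NoDirty.meet ?_
    rintro r ⟨c', -, hr⟩
    exact h g c' r hr

theorem State.loadInto_pers (s : State S) (y : Option S.Var) : (s.loadInto y).pers = s.pers := by
  cases y <;> rfl

/-- A location that is dirty after an instruction was dirtied by it, or was dirty before and not
the location of a `clwb`. -/
theorem dirties_or_of_transfer_pers_dirty {T : Table S} (hT : T.NoDirty) {i : Instr S}
    {s : State S} {l : Loc S} (h : (transfer T i s).pers l = .dirty) :
    i.dirties = some l ∨ (s.pers l = .dirty ∧ i ≠ .clwb l) := by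
  cases i with
  | alloc x =>
    refine .inr ⟨?_, by simp⟩
    cases l <;> simp only [transfer, State.allocVar, State.overwrite] at h
    case field z f => split_ifs at h; exact h
    all_goals exact h
  | setIdx j =>
    refine .inr ⟨?_, by simp⟩
    cases l <;> simp only [transfer, State.resetIdx] at h
    case elem a i => split_ifs at h; exact h
    all_goals exact h
  | store l' v =>
    simp only [transfer, State.doStore, State.setPers, State.escapeVal] at h
    split_ifs at h with hl
    · exact .inl (by rw [hl]; rfl)
    · exact .inr ⟨h, by simp⟩
  | load a y l' =>
    simp only [transfer, State.doLoad, State.loadInto_pers] at h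
    simp only [Instr.dirties]
    split_ifs at h ⊢ with ha
    · simp only [State.setPers] at h
      split_ifs at h with hl
      · exact .inl (by rw [hl])
      · exact .inr ⟨h, by simp⟩
    · exact .inr ⟨h, by simp⟩
  | rmw y l' v =>
    by_cases hl : l = l'
    · exact .inl (by rw [hl]; rfl)
    · simp only [transfer, State.doStore, State.doLoad, State.setPers, State.escapeVal,
        State.loadInto_pers, State.doFence, hl, Bool.true_or, if_true, if_false] at h
      split_ifs at h
      exact .inr ⟨h, by simp⟩
  | flush l' =>
    simp only [transfer, State.setPers] at h
    split_ifs at h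
    exact .inr ⟨h, by simp⟩
  | clwb l' =>
    simp only [transfer, State.doClwb_pers] at h
    split_ifs at h with hl
    refine .inr ⟨h, ?_⟩
    rintro ⟨⟩
    exact hl ⟨rfl, h⟩
  | fence =>
    simp only [transfer, State.doFence] at h
    split_ifs at h
    exact .inr ⟨h, by simp⟩
  | volLoad y => exact .inr ⟨h, by simp⟩
  | call y g args =>
    refine .inr ⟨?_, by simp⟩
    have hr := hT.lookup g (s.callCtx args)
    have hargs : ∀ l, (s.afterArgs (lookup T g (s.callCtx args)) args).pers l = .dirty →
        s.pers l = .dirty := by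
      intro l h
      cases l <;> simp only [State.afterArgs] at h
      case field z f =>
        split_ifs at h
        · refine absurd h (lowestP_ne_dirty ?_)
          rintro _ ⟨j, -, rfl⟩
          exact hr _
        · exact h
      all_goals exact h
    refine hargs l ?_
    cases y with
    | none => exact h
    | some y =>
      cases l <;> simp only [transfer, State.afterRet] at h
      case field z f =>
        split_ifs at h
        · exact absurd h (hr _)
        · exact h
      all_goals exact h
  | _ => exact .inr ⟨h, by simp⟩

section NoDirty

variable {P : Program S} {T : Table S} {p : S.Fn → S.Blk → ℕ → Prop} {F : S.Fn}
  {C : Ctx (S.arity F)}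

theorem mergeOpt_noDirty {X : Set (State S)} {s : State S} (h : ∀ s ∈ X, s.NoDirty)
    (hs : mergeOpt X = some s) : s.NoDirty := by
  obtain ⟨-, rfl⟩ := mergeOpt_eq_some hs
  intro l
  refine lowestP_ne_dirty ?_
  rintro _ ⟨s, hs, rfl⟩
  exact h s hs l

/-- From a state without dirty locations, a location is dirty only right before a `clwb` of it. -/
theorem block_noDirty (hP : ∀ F b, Flushed (P.body F b)) (hT : T.NoDirty) {b : S.Blk}
    {s : State S} (hs : s.NoDirty) :
    (∀ k' i, ((fenceWith P p).body F b)[k']? = some i → i = .fence ∨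
      ∀ l, (transferList T (((fenceWith P p).body F b).take k') s).pers l = .dirty →
        i = .clwb l) ∧
    (transferList T ((fenceWith P p).body F b) s).NoDirty := by
  have key := fenceList_trace T (p := p F b) (is := P.body F b) (s := s)
    (I := fun k u => ∀ l, u.pers l = .dirty → (P.body F b)[k]? = some (.clwb l))
    (fun l hl => absurd hl (hs l)) (by
      intro k i u hi hu l hl
      rcases dirties_or_of_transfer_pers_dirty hT hl with hd | ⟨hd, hne⟩
      · exact hP F b k i l hi hd
      · have := hu l (State.fenceIf_pers_dirty hd)
        rw [hi] at this
        exact absurd (Option.some.inj this) hne)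
  refine ⟨fun k' i hi => (key.1 k' i hi).imp_right ?_, ?_⟩
  · rintro ⟨k, u, hk, hu, he⟩ l hl
    have := hu l (State.fenceIf_pers_dirty (he ▸ hl))
    rw [hk] at this
    exact Option.some.inj this
  · obtain ⟨u, hu, he⟩ := key.2
    intro l hl
    have := hu l (State.fenceIf_pers_dirty (he ▸ hl))
    simp at this

theorem solve_noDirty (hP : ∀ F b, Flushed (P.body F b)) (hT : T.NoDirty)
    (hC : ∀ j, (C j).2 ≠ .dirty) {b : S.Blk} {s : State S}
    (h : solve (fenceWith P p) T F C b = some s) : s.NoDirty := by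
  have hiter : ∀ n b s, iter (fenceWith P p) T F C n b = some s → s.NoDirty := by
    intro n
    induction n with
    | zero =>
      intro b s h
      refine mergeOpt_noDirty ?_ h
      rintro _ ⟨-, rfl⟩ l
      cases l with
      | field x f =>
        refine lowestP_ne_dirty ?_
        rintro _ ⟨j, -, rfl⟩
        exact hC j
      | _ => simp [entryState]
    | succ n ih =>
      intro b s h
      refine mergeOpt_noDirty ?_ h
      rintro s (hs | ⟨b', succs, s', -, -, hs', rfl⟩)
      · exact ih b s hs
      · exact (block_noDirty hP hT (ih b' s' hs')).2
  refine mergeOpt_noDirty ?_ h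
  rintro s ⟨n, hn⟩
  exact hiter n b s hn

theorem InstrAt.eq_clwb_of_dirty (hP : ∀ F b, Flushed (P.body F b)) (hT : T.NoDirty)
    (hC : ∀ j, (C j).2 ≠ .dirty) {b : S.Blk} {k : ℕ} {i : Instr S} {s : State S}
    (h : InstrAt (fenceWith P p) T F C b k i s) (hi : i ≠ .fence) {l : Loc S}
    (hl : s.pers l = .dirty) : i = .clwb l := by
  obtain ⟨hk, hs⟩ := h
  obtain ⟨t, ht, rfl⟩ := Option.map_eq_some_iff.1 hs
  exact ((block_noDirty hP hT (solve_noDirty hP hT hC ht)).1 k i hk).resolve_left hi l hl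

theorem stateAt_length_noDirty (hP : ∀ F b, Flushed (P.body F b)) (hT : T.NoDirty)
    (hC : ∀ j, (C j).2 ≠ .dirty) {b : S.Blk} {s : State S}
    (h : stateAt (fenceWith P p) T F C b ((fenceWith P p).body F b).length = some s) :
    s.NoDirty := by
  obtain ⟨t, ht, rfl⟩ := Option.map_eq_some_iff.1 h
  rw [List.take_length]
  exact (block_noDirty hP hT (solve_noDirty hP hT hC ht)).2

/-- In a program with flushes and any further fences, no dirty state crosses a call boundary. -/
theorem Run.noDirty (hP : ∀ F b, Flushed (P.body F b)) {W : WState S}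
    (h : Run (fenceWith P p) W) :
    W.table.NoDirty ∧ ∀ q, W.Tracked q → ∀ j, (q.2 j).2 ≠ .dirty := by
  induction h with
  | refl =>
    refine ⟨fun F C r h => (by cases h), ?_⟩
    rintro q (hq | hq)
    · exact absurd rfl hq
    · intro j
      have hq : q.2 = fun _ => (.captured, .clean) := hq
      simp [hq]
  | @tail W _ _ hstep ih =>
    obtain ⟨F, C, hF, rfl⟩ := hstep
    obtain ⟨hT, hd⟩ := ih
    have hC := hd ⟨F, C⟩ (.inr hF)
    have htracked : ∀ q, updateTable (fenceWith P p) W.table F C q.1 q.2 ≠ none →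
        W.Tracked q := by
      intro q h
      by_cases hq : q = ⟨F, C⟩
      · exact .inr (hq ▸ hF)
      · exact .inl (by rwa [updateTable_of_ne _ _ _ _ hq] at h)
    refine ⟨fun F₁ C₁ r hr => ?_, ?_⟩
    · by_cases hq : (⟨F₁, C₁⟩ : Pair S) = ⟨F, C⟩
      · cases hq
        have hr' := (updateTable_self (fenceWith P p) W.table F C).symm.trans hr
        cases hr'
        refine Result.NoDirty.meet ?_
        rintro r (h | rfl)
        · exact hT F C r h
        · intro a
          refine lowestP_ne_dirty ?_
          rintro _ ⟨b, v, s, x, f, he, -, rfl⟩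
          exact stateAt_length_noDirty hP hT hC he.2 _
      · exact hT F₁ C₁ r ((updateTable_of_ne (fenceWith P p) W.table F C hq).symm.trans hr)
    · rintro q (h | h | ⟨⟨b, k, y, g, args, s, hi, rfl⟩, -⟩ | ⟨-, h, -⟩)
      · exact hd q (htracked q h)
      · exact hd q (.inr h.1)
      · intro j
        refine lowestP_ne_dirty ?_
        rintro _ ⟨f, rfl⟩ hl
        have := hi.eq_clwb_of_dirty hP hT hC (by simp) hl
        cases this
      · exact hd q (htracked q h)

end NoDirty

/-! ### Reports in the fenced program -/

/-- With everything clean, an instruction leaves at most the location that it dirties non-clean. -/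
theorem not_reportedAt_of_clean {T : Table S} {i : Instr S} {s : State S}
    (h : ∀ l, s.pers l = .clean) : ¬ reportedAt T i s := by
  have hbad : ∀ l, ¬ s.Bad l := fun l hl => hl.2 (h l)
  rintro (⟨-, x, hx⟩ | hr)
  · exact hx (h _)
  · cases i with
    | store l v =>
      obtain ⟨l₁, l₂, hne, -, h₁, h₂⟩ := hr
      have key : ∀ l', (transfer T (.store l v) s).Bad l' → l' = l := by
        intro l' hl'
        by_contra hn
        exact hl'.2 (by simp [transfer, State.doStore, State.setPers, State.escapeVal, hn, h])
      exact hne ((key _ h₁).trans (key _ h₂).symm)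
    | rmw y l v =>
      obtain ⟨l₁, l₂, hne, -, h₁, h₂⟩ := hr
      have key : ∀ l', (transfer T (.rmw y l v) s).Bad l' → l' = l := by
        intro l' hl'
        by_contra hn
        exact hl'.2 (by simp [transfer, State.doStore, State.doLoad, State.setPers,
          State.escapeVal, State.loadInto_pers, State.doFence, hn, h])
      exact hne ((key _ h₁).trans (key _ h₂).symm)
    | volStore rel v =>
      rcases hr with ⟨l₁, l₂, -, -, h₁, -⟩ | ⟨-, l, hl⟩
      · exact h₁.2 (h l₁)
      · exact hl.2 (h l)
    | unlock => exact hr.elim hbad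
    | call y g args => exact hr.2.elim fun l hl => hbad l hl.1
    | setIdx j => exact hr.elim fun a ha => ha (h _)
    | _ => exact hr

theorem PState.eq_clean {p : PState} (h₁ : p ≠ .dirty) (h₂ : p ≠ .clwb) : p = .clean := by
  cases p <;> simp_all

theorem not_reportedAt_fence (T : Table S) (s : State S) : ¬ reportedAt T .fence s := by
  rintro (⟨h, -⟩ | h)
  · exact h trivial
  · exact h

theorem not_reportedAt_clwb (T : Table S) (s : State S) (l : Loc S) :
    ¬ reportedAt T (.clwb l) s := by
  rintro (⟨h, -⟩ | h)
  · exact h trivial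
  · exact h

/-- A program for which a completed analysis reports nothing has no report in any run. -/
theorem not_reports_of_outcome {P : Program S} {W : WState S} (hW : Outcome P W)
    (h : ∀ F C, W.table F C ≠ none → ¬ Reported P W.table F C) : ¬ Reports P := by
  rintro ⟨W', hrun, F, C', hq, hr⟩
  rw [← fenceWith_false P] at hrun hr
  have hcl := hW.closed
  obtain ⟨hb, hd⟩ := hrun.compare hW
  obtain ⟨C, hC, hne⟩ := hd ⟨F, C'⟩ hq
  refine h F C hne ?_
  rcases hr with ⟨b, k', ⟨i, s', hi, hrep⟩ | ⟨rfl, s', hs', hpp⟩⟩ | ⟨l, hl, hout⟩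
  · rcases hi.compare hcl hb hne hC with rfl | ⟨k, s, u, hs, hle, rfl⟩
    · exact absurd hrep (not_reportedAt_fence _ _)
    · have hle' := hle.trans (u.le_fenceIf False)
      exact .inl ⟨b, k, .inl ⟨i, s, hs, hrep.anti hle' (hcl.callLE hb hne hs hle')⟩⟩
  · obtain ⟨s, u, hs, hle, rfl⟩ := stateAt_length_compare hcl hb hne hC hs'
    exact .inl ⟨b, _, .inr ⟨rfl, s, hs, hpp.anti (hle.trans (u.le_fenceIf _))⟩⟩
  · refine .inr ⟨l, hl.anti (State.le_merge ?_), hout⟩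
    rintro s' ⟨b, v, he⟩
    obtain ⟨s, u, hs, hle, rfl⟩ := he.compare hcl hb hne hC
    exact le_trans (State.merge_le (X := {s | ∃ b v, ExitAt P W.table F C b v s}) ⟨b, v, hs⟩)
      (hle.trans (u.le_fenceIf _))

/-- Fences at the positions of a completed analysis of a program with flushes remove all reports. -/
theorem not_reports_insertFences {P : Program S} (hP : ∀ F b, Flushed (P.body F b)) {W : WState S}
    (hW : Outcome P W) : ¬ Reports (insertFences P W.table) := by
  rintro ⟨W', hrun, F, C', hq, hr⟩
  change Run (fenceWith P (FencePos P W.table)) W' at hrun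
  change Reported (fenceWith P (FencePos P W.table)) W'.table F C' at hr
  have hcl := hW.closed
  obtain ⟨hb, hd⟩ := hrun.compare hW
  obtain ⟨C, hC, hne⟩ := hd ⟨F, C'⟩ hq
  obtain ⟨hT', hd'⟩ := hrun.noDirty hP
  have hC' := hd' ⟨F, C'⟩ hq
  -- At the exits everything is clean: a location in state `clwb` has called for a fence.
  have hexit : ∀ {b v s'}, ExitAt (fenceWith P (FencePos P W.table)) W'.table F C' b v s' →
      ∀ l, s'.pers l = .clean := by
    intro b v s' he l
    have hnd := stateAt_length_noDirty hP hT' hC' he.2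
    obtain ⟨s, u, hs, hle, rfl⟩ := he.compare hcl hb hne hC
    refine PState.eq_clean (hnd l) fun hl => ?_
    by_cases hp : FencePos P W.table F b (P.body F b).length
    · exact State.fenceIf_pers_ne_clwb hp u l hl
    · rw [State.fenceIf_of_not hp] at hl
      have hW₁ : Run (fenceWith P fun _ _ _ => False) W := by
        rw [fenceWith_false]
        exact hW.1
      obtain ⟨hT, hd₁⟩ := hW₁.noDirty hP
      have hs' := hs.2
      rw [← fenceWith_false P] at hs'
      have hnd' := stateAt_length_noDirty hP hT (hd₁ ⟨F, C⟩ (.inl hne)) hs'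
      refine hp ⟨C, hne, .inr ⟨rfl, v, s, l, hs, ?_⟩⟩
      by_contra hn
      have := (State.le_iff.1 hle).2.1 l
      rw [PState.eq_clean (hnd' l) hn, hl] at this
      exact absurd this (by decide)
  rcases hr with ⟨b, k', ⟨i, s', hi, hrep⟩ | ⟨rfl, s', hs', hpp⟩⟩ | ⟨l, ⟨-, hl⟩, -⟩
  · by_cases hif : i = .fence
    · subst hif
      exact not_reportedAt_fence _ _ hrep
    -- A report at `i` would also be one in the original program, so there is a fence before `i`.
    refine not_reportedAt_of_clean (fun l => PState.eq_clean ?_ ?_) hrep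
    · intro hl
      have hic := hi.eq_clwb_of_dirty hP hT' hC' hif hl
      subst hic
      exact not_reportedAt_clwb _ _ _ hrep
    · obtain ⟨k, s, u, hs, hle, rfl⟩ := (hi.compare hcl hb hne hC).resolve_left hif
      have hle' := hle.trans (u.le_fenceIf (FencePos P W.table F b k))
      have hrep' := hrep.anti hle' (hcl.callLE hb hne hs hle')
      exact State.fenceIf_pers_ne_clwb ⟨C, hne, .inl (.inl ⟨i, s, hs, hrep'⟩)⟩ u l
  · have hnd := stateAt_length_noDirty hP hT' hC' hs'
    obtain ⟨s, u, hs, hle, rfl⟩ := stateAt_length_compare hcl hb hne hC hs'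
    have hp : FencePos P W.table F b (P.body F b).length :=
      ⟨C, hne, .inl (.inr ⟨rfl, s, hs, hpp.anti (hle.trans (u.le_fenceIf _))⟩)⟩
    obtain ⟨x, hx⟩ := hpp
    exact hx (PState.eq_clean (hnd _) (State.fenceIf_pers_ne_clwb hp u _))
  · refine hl (le_antisymm (PState.le_clean _) (le_lowestP ?_))
    rintro _ ⟨s', ⟨b, v, he⟩, rfl⟩
    rw [hexit he]

end PMRobust

theorem mainTheorem3 (S : PMRobust.Sig) (P : PMRobust.Program S) :
    (∃ P' : PMRobust.Program S, PMRobust.Transforms P P') ∧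
      ∀ P' : PMRobust.Program S, PMRobust.Transforms P P' → ¬ PMRobust.Reports P' := by
  refine ⟨?_, fun P' hP' => ?_⟩
  · obtain ⟨W, hW⟩ := PMRobust.exists_outcome (PMRobust.insertFlushes P)
    exact ⟨_, .inserted W hW⟩
  · cases hP' with
    | unchanged W hW h => exact PMRobust.not_reports_of_outcome hW h
    | inserted W hW =>
      exact PMRobust.not_reports_insertFences
        (fun F b => PMRobust.flushed_flatMap (P.body F b)) hW
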